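/- Let $K$ be a field of characteristic $0$ that is complete with respect to a nontrivial nonarchimedean absolute value, and let $\mathbf{La}$ be the category of manifolds, i.e. of paracompact (Hausdorff) finite-dimensional locally $K$-analytic manifolds belonging to a fixed universe, with the locally $K$-analytic maps as morphisms. Equip $\mathbf{La}$ with the topology generated by open coverings, and let $y\colon \mathbf{La}\to \mathrm{Sh}(\mathbf{La})$ be the Yoneda embedding into the category of sheaves of sets. Let $G$ be a Lie group over $K$, i.e. a group object of $\mathbf{La}$, and let $BG$ be its classifying topos: the category of sheaves on $\mathbf{La}$ with an action of the sheaf of groups $y(G)$, with equivariant morphisms. Write $\Gamma(X,-)=\mathrm{Hom}_{BG}(X,-)$ for $X\in BG$, and $\Gamma=\Gamma(*,-)$ where $*$ is the terminal object. For an abelian group object $\mathcal A$ of $BG$ put $H^n(G,\mathcal A):=(R^n\Gamma)(\mathcal A)$, where $R^n\Gamma$ is the $n$-th right derived functor of $\Gamma$ from abelian group objects of $BG$ to abelian groups. Let $E_\bullet G$ be the simplicial manifold with $E_pG=G^{p+1}$, where a monotone map $\varphi\colon\{0<\dots<p\}\to\{0<\dots<q\}$ induces $E_qG\to E_pG$,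 $(g_0,\dots,g_q)\mapsto(g_{\varphi(0)},\dots,g_{\varphi(p)})$, and regard $y(E_\bullet G)$, with the diagonal action of $y(G)$ by left multiplication, as a simplicial object of $BG$. For an abelian group object $\mathcal A$ of $BG$, the sections $\Gamma(y(E_pG),\mathcal A)$, $p\ge 0$, form a cosimplicial abelian group $\Gamma(E_\bullet G,\mathcal A)$; let $H^n(\Gamma(E_\bullet G,\mathcal A))$ denote the $n$-th cohomology group of the associated cochain complex, whose differential is the alternating sum of the coface maps. Then for every $n\ge 0$ there is an isomorphism of abelian groups, natural in the abelian group object $\mathcal A$ of $BG$, $$H^n(G,\mathcal A)\;\cong\; H^n\big(\Gamma(E_\bullet G,\mathcal A)\big).$$ -/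

import Mathlib

open CategoryTheory Opposite
open scoped Manifold ContDiff

universe u

/-- A locally `K`-analytic manifold: a paracompact Hausdorff space with an analytic atlas
modelled on a finite-dimensional normed `K`-vector space. -/
structure AnMan (K : Type u) [NontriviallyNormedField K] where
  carrier : Type u
  model : Type u
  [normedAddCommGroup : NormedAddCommGroup model]
  [normedSpace : NormedSpace K model]
  [finiteDimensional : FiniteDimensional K model]
  [topologicalSpace : TopologicalSpace carrier]
  [t2Space : T2Space carrier]
  [paracompactSpace : ParacompactSpace carrier]
  [chartedSpace : ChartedSpace model carrier]
  [isManifold : IsManifold 𝓘(K, model) ω carrier]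

namespace AnMan

attribute [instance] normedAddCommGroup normedSpace finiteDimensional topologicalSpace t2Space
  paracompactSpace chartedSpace isManifold

variable {K : Type u} [NontriviallyNormedField K]

instance : CoeSort (AnMan K) (Type u) := ⟨AnMan.carrier⟩

/-- The category of manifolds and (locally `K`-analytic) maps. -/
instance : Category.{u} (AnMan K) where
  Hom X Y := C^ω⟮𝓘(K, X.model), X; 𝓘(K, Y.model), Y⟯
  id _ := ContMDiffMap.id
  comp f g := ContMDiffMap.comp g f

instance (X Y : AnMan K) : FunLike (X ⟶ Y) X Y :=
  inferInstanceAs (FunLike C^ω⟮𝓘(K, X.model), X; 𝓘(K, Y.model), Y⟯ X Y)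

/-- The morphism given by an analytic map. -/
def homMk {X Y : AnMan K} (f : X → Y) (hf : ContMDiff 𝓘(K, X.model) 𝓘(K, Y.model) ω f) :
    X ⟶ Y := (⟨f, hf⟩ : C^ω⟮𝓘(K, X.model), X; 𝓘(K, Y.model), Y⟯)

@[simp] theorem homMk_apply {X Y : AnMan K} (f : X → Y)
    (hf : ContMDiff 𝓘(K, X.model) 𝓘(K, Y.model) ω f) (x : X) : homMk f hf x = f x := rfl

@[simp] theorem id_apply (X : AnMan K) (x : X) : (𝟙 X : X ⟶ X) x = x := rfl

@[simp] theorem comp_apply {X Y Z : AnMan K} (f : X ⟶ Y) (g : Y ⟶ Z) (x : X) :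
    (f ≫ g) x = g (f x) := rfl

@[ext] theorem hom_ext {X Y : AnMan K} {f g : X ⟶ Y} (h : ∀ x, f x = g x) : f = g :=
  DFunLike.ext _ _ h

theorem contMDiff {X Y : AnMan K} (f : X ⟶ Y) : ContMDiff 𝓘(K, X.model) 𝓘(K, Y.model) ω f :=
  ContMDiffMap.contMDiff f

/-- Open embeddings that are isomorphisms of manifolds onto their image: injective local
analytic isomorphisms. -/
def IsOpenImmersion {Y X : AnMan K} (f : Y ⟶ X) : Prop :=
  Function.Injective f ∧ IsLocalDiffeomorph 𝓘(K, Y.model) 𝓘(K, X.model) ω f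

theorem IsOpenImmersion.comp {X Y Z : AnMan K} {f : X ⟶ Y} {g : Y ⟶ Z}
    (hf : IsOpenImmersion f) (hg : IsOpenImmersion g) : IsOpenImmersion (f ≫ g) :=
  ⟨hg.1.comp hf.1, fun x => (hf.2 x).comp (K := 𝓘(K, Z.model)) (hg := hg.2 (f x))⟩

/-- A function `h` with analytic `f ∘ h`, for `f` an open immersion, is analytic. -/
theorem IsOpenImmersion.lift {X Y Z : AnMan K} {f : Y ⟶ X} (hf : IsOpenImmersion f)
    (g : Z ⟶ X) (hg : ∀ z, ∃ y, f y = g z) : ∃ h : Z ⟶ Y, h ≫ f = g := by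
  choose h hh using hg
  refine ⟨homMk h fun z => ?_, hom_ext hh⟩
  obtain ⟨Φ, hz, he⟩ := hf.2 (h z)
  have hgz : g z ∈ Φ.target := by
    rw [← hh z, he hz]; exact Φ.map_source hz
  have h1 : ContMDiffAt 𝓘(K, Z.model) 𝓘(K, Y.model) ω (Φ.invFun ∘ g) z :=
    ((Φ.contMDiffOn_invFun).contMDiffAt (Φ.open_target.mem_nhds hgz)).comp z (contMDiff g z)
  refine h1.congr_of_eventuallyEq ?_
  filter_upwards [(contMDiff g).continuous.continuousAt.preimage_mem_nhds
    (Φ.open_target.mem_nhds hgz)] with w hw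
  apply hf.1
  rw [hh w, Function.comp_apply]
  exact ((he (Φ.map_target hw)).trans (Φ.right_inv hw)).symm

/-- A (paracompact) open subset of a manifold, as a manifold. -/
noncomputable def opens (X : AnMan K) (V : TopologicalSpace.Opens X) [ParacompactSpace V] :
    AnMan K where
  carrier := V
  model := X.model

/-- The inclusion of an open subset. -/
noncomputable def opensVal (X : AnMan K) (V : TopologicalSpace.Opens X) [ParacompactSpace V] :
    X.opens V ⟶ X :=
  ⟨fun v : V => v.1, contMDiff_subtype_val (I := 𝓘(K, X.model)) (U := V)⟩

theorem isOpenImmersion_opensVal (X : AnMan K) (V : TopologicalSpace.Opens X)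
    [ParacompactSpace V] : IsOpenImmersion (X.opensVal V) := by
  refine ⟨Subtype.val_injective, fun (y : V) => ?_⟩
  change IsLocalDiffeomorphAt 𝓘(K, X.model) 𝓘(K, X.model) ω (fun v : V => v.1) y
  classical
  refine ⟨{ toFun := fun v : V => v.1
            invFun := fun z => if h : z ∈ V then ⟨z, h⟩ else y
            source := Set.univ
            target := V
            map_source' := fun v _ => v.2
            map_target' := fun _ _ => Set.mem_univ _
            left_inv' := fun v _ => dif_pos v.2
            right_inv' := fun z hz => by
              rw [dif_pos (show z ∈ V from hz)]
            open_source := isOpen_univ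
            open_target := V.2
            contMDiffOn_toFun := contMDiff_subtype_val.contMDiffOn
            contMDiffOn_invFun := ?_ }, Set.mem_univ y, fun _ _ => rfl⟩
  intro z hz
  refine ContMDiffAt.contMDiffWithinAt ?_
  refine (ChartedSpace.liftPropWithinAt_subtypeVal_comp_iff
    (P := ContDiffWithinAtProp 𝓘(K, X.model) 𝓘(K, X.model) ω) _ _ _).1 ?_
  change ContMDiffAt 𝓘(K, X.model) 𝓘(K, X.model) ω _ z
  refine contMDiffAt_id.congr_of_eventuallyEq ?_
  filter_upwards [V.2.mem_nhds hz] with w hw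
  simp only [Function.comp_apply]
  rw [dif_pos (show w ∈ V from hw)]; rfl

/-- Every neighbourhood of a point contains an open submanifold around this point. -/
theorem exists_openImmersion {X : AnMan K} (x : X) (U : Set X) (hU : IsOpen U) (hx : x ∈ U) :
    ∃ (Y : AnMan K) (f : Y ⟶ X), IsOpenImmersion f ∧ x ∈ Set.range f ∧ Set.range f ⊆ U := by
  let e := chartAt X.model x
  let V : TopologicalSpace.Opens X := ⟨U ∩ e.source, hU.inter e.open_source⟩
  have hemb : Topology.IsEmbedding (fun v : V => e v.1) := by
    have h1 := e.isOpenEmbedding_restrict.isEmbedding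
    exact h1.comp (Topology.IsEmbedding.inclusion (s := (V : Set X)) (fun v hv => hv.2))
  have : TopologicalSpace.MetrizableSpace V := hemb.metrizableSpace
  have : ParacompactSpace V := by
    let := TopologicalSpace.metrizableSpaceMetric V
    infer_instance
  refine ⟨X.opens V, X.opensVal V, isOpenImmersion_opensVal X V,
    ⟨(⟨x, hx, mem_chart_source _ x⟩ : V), rfl⟩, ?_⟩
  rintro _ ⟨v, rfl⟩
  exact (show V from v).2.1

variable (K) in
/-- The topology generated by open coverings: a sieve is covering if it contains a family of
open embeddings with jointly surjective images. -/
def topology : GrothendieckTopology (AnMan K) where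
  sieves X := {S | ∀ x : X, ∃ (Y : AnMan K) (f : Y ⟶ X), S f ∧ IsOpenImmersion f ∧
    x ∈ Set.range f}
  top_mem' X x := by
    obtain ⟨Y, f, hf, hx, -⟩ := exists_openImmersion x Set.univ isOpen_univ (Set.mem_univ x)
    exact ⟨Y, f, trivial, hf, hx⟩
  pullback_stable' X Z S g hS z := by
    obtain ⟨Y, f, hSf, hf, y, hy⟩ := hS (g z)
    obtain ⟨W, i, hi, hz, hW⟩ := exists_openImmersion z (g ⁻¹' Set.range f)
      (hf.2.isOpen_range.preimage (contMDiff g).continuous) ⟨y, hy⟩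
    refine ⟨W, i, ?_, hi, hz⟩
    obtain ⟨h, hh⟩ := hf.lift (i ≫ g) (fun w => hW ⟨w, rfl⟩)
    change S (i ≫ g)
    rw [← hh]
    exact S.downward_closed hSf h
  transitive' X S hS R hR x := by
    obtain ⟨Y, f, hSf, hf, y, rfl⟩ := hS x
    obtain ⟨W, i, hi, hii, w, rfl⟩ := hR hSf y
    exact ⟨W, i ≫ f, hi, hii.comp hf, w, rfl⟩

/-- The one-point manifold. -/
def point (K : Type u) [NontriviallyNormedField K] : AnMan K where
  carrier := PUnit.{u + 1}
  model := PUnit.{u + 1}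

/-- Representable presheaves are sheaves. -/
instance : (topology K).Subcanonical := by
  refine GrothendieckTopology.Subcanonical.of_isSheaf_yoneda_obj _ fun G X S hS x' hx => ?_
  let x : ∀ {Y : AnMan K} (f : Y ⟶ X), S f → (Y ⟶ G) := fun f hf => x' f hf
  have key : ∀ {Y Y' : AnMan K} (f : Y ⟶ X) (f' : Y' ⟶ X) (hf : S f) (hf' : S f') (y : Y)
      (y' : Y'), f y = f' y' → x f hf y = x f' hf' y' := by
    intro Y Y' f f' hf hf' y y' h
    let c : point K ⟶ Y := homMk (fun _ => y) contMDiff_const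
    let c' : point K ⟶ Y' := homMk (fun _ => y') contMDiff_const
    have := hx c c' hf hf' (hom_ext fun _ => h)
    exact DFunLike.congr_fun (F := point K ⟶ G) this PUnit.unit
  choose Y f hSf hf y hy using hS
  let s : X → G := fun p => x (f p) (hSf p) (y p)
  have hs : ∀ {Z : AnMan K} (g : Z ⟶ X) (hg : S g) (z : Z), s (g z) = x g hg z :=
    fun g hg z => key _ _ _ _ _ _ (hy _)
  have hsm : ContMDiff 𝓘(K, X.model) 𝓘(K, G.model) ω s := by
    intro p
    obtain ⟨Φ, hz, he⟩ := (hf p).2 (y p)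
    have hp : p ∈ Φ.target := by
      have := Φ.map_source hz
      rwa [← show f p (y p) = Φ.toPartialEquiv (y p) from he hz, hy] at this
    have h1 : ContMDiffAt 𝓘(K, X.model) 𝓘(K, G.model) ω
        (x (f p) (hSf p) ∘ Φ.invFun) p :=
      (contMDiff _ _).comp p (Φ.contMDiffOn_invFun.contMDiffAt (Φ.open_target.mem_nhds hp))
    refine h1.congr_of_eventuallyEq ?_
    filter_upwards [Φ.open_target.mem_nhds hp] with w hw
    rw [Function.comp_apply, ← hs]
    exact congrArg s ((he (Φ.map_target hw)).trans (Φ.right_inv hw)).symm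
  refine ⟨homMk s hsm, fun Z g hg => hom_ext fun z => hs g hg z, fun t ht => hom_ext fun p => ?_⟩
  have := DFunLike.congr_fun (F := Y p ⟶ G) (ht (f p) (hSf p)) (y p)
  change (show X ⟶ G from t) (f p (y p)) = _ at this
  rw [hy] at this
  exact this

end AnMan

namespace AnMan

section Powers

variable {K : Type u} [NontriviallyNormedField K]

/-- The product charts on a finite power of a manifold. -/
noncomputable abbrev piCharts (ι : Type) [Fintype ι] (X : AnMan K) :
    ChartedSpace (ι → X.model) (ι → X) :=
  piChartedSpace (fun _ => X.model) (fun _ => X)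

attribute [local instance] piCharts

theorem contMDiff_pi_iff {ι : Type} [Fintype ι] {Y X : AnMan K} (f : Y → ι → X) :
    ContMDiff 𝓘(K, Y.model) 𝓘(K, ι → X.model) ω f ↔
      ∀ i, ContMDiff 𝓘(K, Y.model) 𝓘(K, X.model) ω (fun y => f y i) := by
  simp only [ContMDiff, contMDiffAt_iff]
  rw [forall_comm]
  refine forall_congr' fun y => ?_
  rw [forall_and, continuousAt_pi]
  refine and_congr Iff.rfl ?_
  rw [contDiffWithinAt_pi]
  rfl

theorem isManifold_pi (ι : Type) [Fintype ι] (X : AnMan K) :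
    IsManifold 𝓘(K, ι → X.model) ω (ι → X) := by
  refine isManifold_of_contDiffOn _ _ _ ?_
  rintro _ _ ⟨e, he, rfl⟩ ⟨e', he', rfl⟩
  rw [contDiffOn_pi]
  intro i
  have h := (mem_groupoid_of_pregroupoid.1
    (HasGroupoid.compatible (G := contDiffGroupoid ω 𝓘(K, X.model)) (he i trivial)
      (he' i trivial))).1
  have h' : ContDiffOn K ω ((e i).symm ≫ₕ (e' i)) ((e i).symm ≫ₕ (e' i)).source := by
    simpa [contDiffPregroupoid] using! h
  refine h'.comp (contDiff_apply K X.model i).contDiffOn ?_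
  rintro v ⟨hv, -⟩
  exact ⟨hv.1 i trivial, hv.2 i trivial⟩

end Powers
section LieGroups

variable {K : Type u} [NontriviallyNormedField K]

theorem firstCountable (X : AnMan K) : FirstCountableTopology X := by
  refine ⟨fun x => ?_⟩
  let e := chartAt X.model x
  have h : Filter.map e.symm (nhds (e x)) = nhds x := by
    rw [e.symm.map_nhds_eq (e.map_source (mem_chart_source _ x)),
      e.left_inv (mem_chart_source _ x)]
  rw [← h]
  infer_instance

variable (G : AnMan K) [Group G] [LieGroup 𝓘(K, G.model) ω G]

/-- Finite powers of a Lie group are metrizable, hence paracompact. -/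
theorem paracompactSpace_pi (ι : Type) [Fintype ι] : ParacompactSpace (ι → G) := by
  have := firstCountable G
  have : IsTopologicalGroup G := topologicalGroup_of_lieGroup 𝓘(K, G.model) ω
  let : UniformSpace (ι → G) := IsTopologicalGroup.rightUniformSpace (ι → G)
  have : (uniformity (ι → G)).IsCountablyGenerated := by
    change (Filter.comap (fun p : (ι → G) × (ι → G) => p.2 * p.1⁻¹) (nhds 1)).IsCountablyGenerated
    infer_instance
  let := UniformSpace.metricSpace (ι → G)
  infer_instance

attribute [local instance] piCharts in
/-- A finite power `G × ⋯ × G` of a Lie group, as a manifold. -/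
noncomputable def power (ι : Type) [Fintype ι] : AnMan K where
  carrier := ι → G
  model := ι → G.model
  paracompactSpace := paracompactSpace_pi G ι
  isManifold := isManifold_pi ι G

variable {G}

attribute [local instance] piCharts in
/-- An analytic map into a power of `G` given by its components. -/
def powerLift {ι : Type} [Fintype ι] {X : AnMan K} (f : ι → (X ⟶ G)) : X ⟶ power G ι :=
  ⟨fun x i => f i x, (contMDiff_pi_iff _).2 fun i => contMDiff (f i)⟩

attribute [local instance] piCharts in
/-- The projections of a power of `G`. -/
noncomputable def powerProj {ι : Type} [Fintype ι] (i : ι) : power G ι ⟶ G :=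
  ⟨fun x : ι → G => x i, (contMDiff_pi_iff (Y := power G ι) id).1 contMDiff_id i⟩

theorem power_ext {ι : Type} [Fintype ι] {X : AnMan K} {f g : X ⟶ power G ι}
    (h : ∀ i, f ≫ powerProj i = g ≫ powerProj i) : f = g := by
  ext x
  funext i
  exact DFunLike.congr_fun (h i) x

@[simp] theorem powerLift_proj {ι : Type} [Fintype ι] {X : AnMan K} (f : ι → (X ⟶ G)) (i : ι) :
    powerLift f ≫ powerProj i = f i := rfl

/-- The group of analytic maps `X ⟶ G`, with pointwise multiplication. -/
instance (X : AnMan K) : Group (X ⟶ G) :=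
  inferInstanceAs (Group C^ω⟮𝓘(K, X.model), X; 𝓘(K, G.model), G⟯)

theorem mul_apply {X : AnMan K} (f g : X ⟶ G) (x : X) : (f * g) x = f x * g x := rfl

@[simp] theorem comp_one {X Y : AnMan K} (f : X ⟶ Y) : f ≫ (1 : Y ⟶ G) = 1 := rfl

@[simp] theorem comp_mul {X Y : AnMan K} (f : X ⟶ Y) (g h : Y ⟶ G) :
    f ≫ (g * h) = (f ≫ g) * (f ≫ h) := rfl

variable (G)

/-- The simplicial manifold `E_• G` with `E_p G = G ^ (p + 1)`, where a monotone map `φ` acts by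
`(g_i)_i ↦ (g_{φ i})_i`. -/
noncomputable def E : SimplicialObject (AnMan K) where
  obj p := power G (Fin (p.unop.len + 1))
  map φ := powerLift fun i => powerProj (φ.unop.toOrderHom i)
  map_id _ := rfl
  map_comp _ _ := rfl

end LieGroups

end AnMan

open AnMan

section ClassifyingTopos

variable {K : Type u} [NontriviallyNormedField K]

/-- An object of the classifying topos `BG`: a sheaf of sets `F` on the site of manifolds with an
action `y(G) × F ⟶ F` of the sheaf of groups `y(G) = Hom(-, G)`. -/
structure ClassifyingTopos (G : AnMan K) [Group G] [LieGroup 𝓘(K, G.model) ω G] where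
  sheaf : Sheaf (topology K) (Type (u + 1))
  act : ∀ {X : AnMan K}, (X ⟶ G) → sheaf.obj.obj (op X) → sheaf.obj.obj (op X)
  one_act : ∀ {X : AnMan K} (s : sheaf.obj.obj (op X)), act 1 s = s
  mul_act : ∀ {X : AnMan K} (g h : X ⟶ G) (s : sheaf.obj.obj (op X)),
    act (g * h) s = act g (act h s)
  map_act : ∀ {X Y : AnMan K} (f : Y ⟶ X) (g : X ⟶ G) (s : sheaf.obj.obj (op X)),
    sheaf.obj.map f.op (act g s) = act (f ≫ g) (sheaf.obj.map f.op s)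

variable {G : AnMan K} [Group G] [LieGroup 𝓘(K, G.model) ω G]

namespace ClassifyingTopos

/-- Morphisms of `BG`: equivariant morphisms of sheaves. -/
@[ext]
structure Hom (A B : ClassifyingTopos G) where
  hom : A.sheaf ⟶ B.sheaf
  map_act : ∀ {X : AnMan K} (g : X ⟶ G) (s : A.sheaf.obj.obj (op X)),
    hom.hom.app (op X) (A.act g s) = B.act g (hom.hom.app (op X) s)

instance : Category (ClassifyingTopos G) where
  Hom := Hom
  id A := ⟨𝟙 _, fun _ _ => rfl⟩
  comp f g := ⟨f.hom ≫ g.hom, fun a s =>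
    (congrArg (g.hom.hom.app _) (f.map_act a s)).trans (g.map_act a _)⟩

/-- The value of a morphism of `BG` on a section over `X`. -/
def app {A B : ClassifyingTopos G} (f : A ⟶ B) {X : AnMan K} (s : A.sheaf.obj.obj (op X)) :
    B.sheaf.obj.obj (op X) := (Hom.hom f).hom.app (op X) s

@[simp] theorem id_app (A : ClassifyingTopos G) {X : AnMan K} (s : A.sheaf.obj.obj (op X)) :
    app (𝟙 A) s = s := rfl

@[simp] theorem comp_app {A B C : ClassifyingTopos G} (f : A ⟶ B) (g : B ⟶ C) {X : AnMan K}
    (s : A.sheaf.obj.obj (op X)) : app (f ≫ g) s = app g (app f s) := rfl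

theorem app_act {A B : ClassifyingTopos G} (f : A ⟶ B) {X : AnMan K} (g : X ⟶ G)
    (s : A.sheaf.obj.obj (op X)) : app f (A.act g s) = B.act g (app f s) := Hom.map_act f g s

theorem app_map {A B : ClassifyingTopos G} (f : A ⟶ B) {X Y : AnMan K} (i : Y ⟶ X)
    (s : A.sheaf.obj.obj (op X)) :
    app f (A.sheaf.obj.map i.op s) = B.sheaf.obj.map i.op (app f s) :=
  NatTrans.naturality_apply (Hom.hom f).hom i.op s

theorem hom_ext' {A B : ClassifyingTopos G} {f g : A ⟶ B}
    (h : ∀ {X : AnMan K} (s : A.sheaf.obj.obj (op X)), app f s = app g s) : f = g := by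
  refine Hom.ext ?_
  ext X s
  exact h s

/-- A morphism of `BG` from its values on sections. -/
def homMk' {A B : ClassifyingTopos G}
    (φ : ∀ {X : AnMan K}, A.sheaf.obj.obj (op X) → B.sheaf.obj.obj (op X))
    (hmap : ∀ {X Y : AnMan K} (i : Y ⟶ X) (s : A.sheaf.obj.obj (op X)),
      φ (A.sheaf.obj.map i.op s) = B.sheaf.obj.map i.op (φ s))
    (hact : ∀ {X : AnMan K} (g : X ⟶ G) (s : A.sheaf.obj.obj (op X)),
      φ (A.act g s) = B.act g (φ s)) : A ⟶ B where
  hom := ObjectProperty.homMk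
    { app := fun X => TypeCat.ofHom (φ (X := X.unop))
      naturality := fun X Y i => by
        ext s
        exact hmap i.unop s }
  map_act := hact

@[simp] theorem homMk'_app {A B : ClassifyingTopos G}
    (φ : ∀ {X : AnMan K}, A.sheaf.obj.obj (op X) → B.sheaf.obj.obj (op X)) (hmap) (hact)
    {X : AnMan K} (s : A.sheaf.obj.obj (op X)) :
    app (homMk' (A := A) (B := B) φ hmap hact) s = φ s := rfl

variable (G) in
/-- The terminal object `*` of `BG`: the one-point sheaf. -/
def terminal : ClassifyingTopos G where
  sheaf := Sheaf.terminal (topology K) Limits.Types.isTerminalPUnit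
  act _ s := s
  one_act _ := rfl
  mul_act _ _ _ := rfl
  map_act _ _ _ := rfl

/-- `terminal G` is a terminal object. -/
def isTerminalTerminal : Limits.IsTerminal (terminal G) :=
  Limits.IsTerminal.ofUniqueHom
    (fun _ => homMk' (fun _ => PUnit.unit) (fun _ _ => rfl) (fun _ _ => rfl))
    (fun _ _ => hom_ext' fun _ => rfl)

/-- The object `y(E_p G)` of `BG`, with `G` acting diagonally by left multiplication. -/
noncomputable def EObj (p : SimplexCategoryᵒᵖ) : ClassifyingTopos G where
  sheaf := (topology K).uliftYoneda.{u + 1}.obj ((E G).obj p)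
  act g s := ULift.up (powerLift fun i => g * (s.down ≫ powerProj i))
  one_act s := by
    refine ULift.ext _ _ (power_ext fun i => ?_)
    exact one_mul (s.down ≫ powerProj i)
  mul_act g h s := by
    refine ULift.ext _ _ (power_ext fun i => ?_)
    exact mul_assoc g h (s.down ≫ powerProj i)
  map_act _ _ _ := rfl

variable (G) in
/-- The simplicial object `y(E_• G)` of `BG`. -/
noncomputable def simplicialE : SimplicialObject (ClassifyingTopos G) where
  obj p := EObj p
  map φ :=
    { hom := (topology K).uliftYoneda.{u + 1}.map ((E G).map φ)
      map_act := fun _ _ => rfl }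
  map_id _ := rfl
  map_comp _ _ := rfl

end ClassifyingTopos

/-- An abelian group object of `BG`: an object `A` of `BG` with an abelian group structure on its
sections such that addition `A × A ⟶ A` is a morphism of `BG`. -/
structure AbObject (G : AnMan K) [Group G] [LieGroup 𝓘(K, G.model) ω G] extends
    ClassifyingTopos G where
  [addCommGroup : ∀ X : AnMan K, AddCommGroup (sheaf.obj.obj (op X))]
  map_add : ∀ {X Y : AnMan K} (f : Y ⟶ X) (s t : sheaf.obj.obj (op X)),
    sheaf.obj.map f.op (s + t) = sheaf.obj.map f.op s + sheaf.obj.map f.op t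
  act_add : ∀ {X : AnMan K} (g : X ⟶ G) (s t : sheaf.obj.obj (op X)),
    act g (s + t) = act g s + act g t

namespace AbObject

open ClassifyingTopos

attribute [instance] addCommGroup

/-- The sections of `A` over a manifold. -/
abbrev sec (A : AbObject G) (X : AnMan K) : Type (u + 1) := A.sheaf.obj.obj (op X)

/-- The restriction of sections, as a group homomorphism. -/
def res (A : AbObject G) {X Y : AnMan K} (f : Y ⟶ X) : A.sec X →+ A.sec Y :=
  AddMonoidHom.mk' (fun s => A.sheaf.obj.map f.op s) (A.map_add f)

/-- The action on sections, as a group homomorphism. -/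
def actHom (A : AbObject G) {X : AnMan K} (g : X ⟶ G) : A.sec X →+ A.sec X :=
  AddMonoidHom.mk' (fun s => A.act g s) (A.act_add g)

section HomGroup

variable {B : ClassifyingTopos G} {A : AbObject G}

/-- Morphisms of `BG` into an abelian group object are added pointwise. -/
instance : Add (B ⟶ A.toClassifyingTopos) where
  add f g := homMk' (fun {X} s => (app f s + app g s : A.sec X))
    (fun i s => by
      rw [app_map, app_map]; exact (A.map_add i _ _).symm)
    (fun h s => by
      rw [app_act, app_act]; exact (A.act_add h _ _).symm)

instance : Zero (B ⟶ A.toClassifyingTopos) where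
  zero := homMk' (fun {X} _ => (0 : A.sec X)) (fun i _ => (map_zero (A.res i)).symm)
    (fun h _ => (map_zero (A.actHom h)).symm)

instance : Neg (B ⟶ A.toClassifyingTopos) where
  neg f := homMk' (fun {X} s => (-(app f s) : A.sec X))
    (fun i s => by
      rw [app_map]; exact (_root_.map_neg (A.res i) _).symm)
    (fun h s => by
      rw [app_act]; exact (_root_.map_neg (A.actHom h) _).symm)

theorem add_app (f g : B ⟶ A.toClassifyingTopos) {X : AnMan K} (s : B.sheaf.obj.obj (op X)) :
    app (f + g) s = (app f s + app g s : A.sec X) := rfl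

theorem zero_app {X : AnMan K} (s : B.sheaf.obj.obj (op X)) :
    app (0 : B ⟶ A.toClassifyingTopos) s = (0 : A.sec X) := rfl

theorem neg_app (f : B ⟶ A.toClassifyingTopos) {X : AnMan K} (s : B.sheaf.obj.obj (op X)) :
    app (-f) s = (-(app f s) : A.sec X) := rfl

instance : AddCommGroup (B ⟶ A.toClassifyingTopos) where
  add_assoc f g h := hom_ext' fun {X} s => add_assoc (G := A.sec X) _ _ _
  zero_add f := hom_ext' fun {X} s => zero_add (M := A.sec X) _
  add_zero f := hom_ext' fun {X} s => add_zero (M := A.sec X) _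
  nsmul := nsmulRec
  zsmul := zsmulRec
  neg_add_cancel f := hom_ext' fun {X} s => neg_add_cancel (G := A.sec X) _
  add_comm f g := hom_ext' fun {X} s => add_comm (G := A.sec X) _ _

end HomGroup

/-- Morphisms of abelian group objects of `BG`: additive morphisms of `BG`. -/
@[ext]
structure Hom (A B : AbObject G) where
  hom : A.toClassifyingTopos ⟶ B.toClassifyingTopos
  map_add : ∀ {X : AnMan K} (s t : A.sec X),
    app hom (s + t) = (app hom s + app hom t : B.sec X)

instance : Category (AbObject G) where
  Hom := Hom
  id A := ⟨𝟙 _, fun _ _ => rfl⟩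
  comp f g := ⟨f.hom ≫ g.hom, fun s t => by
    rw [comp_app, f.map_add, g.map_add]; rfl⟩

/-- The underlying morphism of `BG`. -/
def toBG {A B : AbObject G} (f : A ⟶ B) : A.toClassifyingTopos ⟶ B.toClassifyingTopos := f.hom

@[simp] theorem toBG_id (A : AbObject G) : toBG (𝟙 A) = 𝟙 _ := rfl

@[simp] theorem toBG_comp {A B C : AbObject G} (f : A ⟶ B) (g : B ⟶ C) :
    toBG (f ≫ g) = toBG f ≫ toBG g := rfl

theorem toBG_injective {A B : AbObject G} {f g : A ⟶ B} (h : toBG f = toBG g) : f = g :=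
  Hom.ext h

theorem toBG_add {A B : AbObject G} (f : A ⟶ B) {X : AnMan K} (s t : A.sec X) :
    app (toBG f) (s + t) = (app (toBG f) s + app (toBG f) t : B.sec X) := f.map_add s t

/-- The map on sections over `X`, as a group homomorphism. -/
def secHom {A B : AbObject G} (f : A ⟶ B) (X : AnMan K) : A.sec X →+ B.sec X :=
  AddMonoidHom.mk' (fun s => app (toBG f) s) (toBG_add f)

instance (A B : AbObject G) : Add (A ⟶ B) where
  add f g := ⟨toBG f + toBG g, fun {X} s t => by
    rw [add_app, add_app, add_app, toBG_add, toBG_add]; exact add_add_add_comm (G := B.sec X) _ _ _ _⟩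

instance (A B : AbObject G) : Zero (A ⟶ B) where
  zero := ⟨0, fun {X} _ _ => (add_zero (M := B.sec X) _).symm⟩

instance (A B : AbObject G) : Neg (A ⟶ B) where
  neg f := ⟨-toBG f, fun {X} s t => by
    rw [neg_app, neg_app, neg_app, toBG_add]; exact neg_add (α := B.sec X) _ _⟩

instance (A B : AbObject G) : AddCommGroup (A ⟶ B) where
  add_assoc f g h := toBG_injective (add_assoc (toBG f) (toBG g) (toBG h))
  zero_add f := toBG_injective (zero_add (toBG f))
  add_zero f := toBG_injective (add_zero (toBG f))
  nsmul := nsmulRec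
  zsmul := zsmulRec
  neg_add_cancel f := toBG_injective (neg_add_cancel (toBG f))
  add_comm f g := toBG_injective (add_comm (toBG f) (toBG g))

theorem add_toBG {A B : AbObject G} (f g : A ⟶ B) : toBG (f + g) = toBG f + toBG g := rfl

instance : Preadditive (AbObject G) where
  add_comp A B C f f' g := toBG_injective (hom_ext' fun {X} s => by
    change app (toBG g) (app (toBG f) s + app (toBG f') s : B.sec X) = _
    rw [toBG_add]; rfl)
  comp_add A B C f g g' := rfl

end AbObject

/-! The category of abelian group objects of `BG` is abelian with enough injectives: it is
equivalent to the category of abelian sheaves on an auxiliary site. -/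

/-- The auxiliary site: manifolds with morphisms `X ⟶ Y` the pairs of a map `X ⟶ G` and a map
`X ⟶ Y`. (This is the full subcategory of `BG` on the objects `y(G) × y(X)`.) -/
structure ActSite (G : AnMan K) where
  base : AnMan K

namespace ActSite

/-- Morphisms of the auxiliary site. -/
@[ext]
structure Hom (X Y : ActSite G) where
  tw : X.base ⟶ G
  map : X.base ⟶ Y.base

instance : Category.{u} (ActSite G) where
  Hom := Hom
  id _ := ⟨1, 𝟙 _⟩
  comp a b := ⟨a.tw * (a.map ≫ b.tw), a.map ≫ b.map⟩
  id_comp _ := Hom.ext (one_mul _) rfl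
  comp_id _ := Hom.ext (mul_one _) rfl
  assoc _ _ _ := Hom.ext (mul_assoc _ _ _) rfl

variable (G) in
/-- The inclusion of the site of manifolds. -/
def incl : AnMan K ⥤ ActSite G where
  obj X := ⟨X⟩
  map f := ⟨1, f⟩
  map_comp f g := Hom.ext (one_mul (1 : _ ⟶ G)).symm rfl

/-- The twist of an object by a map to `G`. -/
def twist (X : ActSite G) (g : X.base ⟶ G) : X ⟶ X := ⟨g, 𝟙 _⟩

theorem eq_twist_comp {X Y : ActSite G} (a : X ⟶ Y) :
    a = twist X a.tw ≫ (incl G).map a.map := Hom.ext (mul_one _).symm rfl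

theorem twist_mul (X : ActSite G) (g h : X.base ⟶ G) :
    twist X (g * h) = twist X g ≫ twist X h := rfl

theorem twist_one (X : ActSite G) : twist X 1 = 𝟙 X := rfl

theorem incl_comp_twist {X Y : AnMan K} (f : Y ⟶ X) (g : X ⟶ G) :
    (incl G).map f ≫ twist ⟨X⟩ g = twist ⟨Y⟩ (f ≫ g) ≫ (incl G).map f :=
  Hom.ext ((one_mul (f ≫ g)).trans (mul_one (f ≫ g)).symm) rfl

theorem map_map (P : (ActSite G)ᵒᵖ ⥤ Type (u + 1)) {X Y Z : ActSite G} {a : Y ⟶ X} {b : Z ⟶ Y}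
    {c : Z ⟶ X} (h : b ≫ a = c) (s : P.obj (op X)) : P.map b.op (P.map a.op s) = P.map c.op s := by
  subst h
  rw [op_comp, P.map_comp]; rfl

theorem map_map' (P : (ActSite G)ᵒᵖ ⥤ AddCommGrpCat.{u + 1}) {X Y Z : ActSite G} {a : Y ⟶ X}
    {b : Z ⟶ Y} {c : Z ⟶ X} (h : b ≫ a = c) (s : P.obj (op X)) :
    P.map b.op (P.map a.op s) = P.map c.op s := by
  subst h
  rw [op_comp, P.map_comp]; rfl

variable (G) in
/-- The topology on the auxiliary site. -/
def topology : GrothendieckTopology (ActSite G) where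
  sieves X := {S | Sieve.functorPullback (X := X.base) (incl G) S ∈ AnMan.topology K X.base}
  top_mem' X := (AnMan.topology K).top_mem X.base
  pullback_stable' X Z S a hS := by
    have h := (AnMan.topology K).pullback_stable a.map hS
    refine (AnMan.topology K).superset_covering ?_ h
    intro W f hf
    change S ((incl G).map f ≫ a)
    have : (incl G).map f ≫ a =
        twist (⟨W⟩ : ActSite G) (f ≫ a.tw) ≫ (incl G).map (f ≫ a.map) :=
      Hom.ext ((one_mul (f ≫ a.tw)).trans (mul_one (f ≫ a.tw)).symm) rfl
    rw [this]
    exact S.downward_closed hf _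
  transitive' X S hS R hR := by
    refine (AnMan.topology K).transitive hS _ fun W f hf => ?_
    refine (AnMan.topology K).superset_covering ?_ (hR hf)
    intro V i hi
    change R ((incl G).map (i ≫ f))
    rw [Functor.map_comp]
    exact hi

/-- A presheaf on the auxiliary site is a sheaf iff its restriction to manifolds is. -/
theorem isSheaf_iff (P : (ActSite G)ᵒᵖ ⥤ Type (u + 1)) :
    Presieve.IsSheaf (topology G) P ↔ Presieve.IsSheaf (AnMan.topology K) ((incl G).op ⋙ P) := by
  constructor
  · intro hP X S hS x hx
    -- the sieve generated by the image of `S`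
    let S' : Sieve ((incl G).obj X) :=
      { arrows := fun W a => S (Hom.map a)
        downward_closed := fun {W V a} ha b => S.downward_closed ha (Hom.map b) }
    have hS' : S' ∈ topology G ((incl G).obj X) := hS
    let x' : Presieve.FamilyOfElements P S'.arrows := fun W a ha =>
      P.map (twist W a.tw).op (x (Hom.map a) ha)
    have hx' : x'.Compatible := by
      rw [Presieve.compatible_iff_sieveCompatible]
      intro W V a b ha
      have h := (Presieve.compatible_iff_sieveCompatible x).1 hx (Hom.map a) (Hom.map b) ha
      change P.map (twist V (b ≫ a).tw).op (x (Hom.map b ≫ Hom.map a) _) =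
        P.map b.op (P.map (twist W a.tw).op (x (Hom.map a) ha))
      rw [h]
      refine (map_map P (a := (incl G).map (Hom.map b)) (b := twist V (b ≫ a).tw)
        (c := b ≫ twist W a.tw) (Hom.ext (mul_one _) rfl) _).trans ?_
      exact (map_map P rfl _).symm
    obtain ⟨t, ht, hu⟩ := hP S' hS' x' hx'
    have key : ∀ t : P.obj (op ((incl G).obj X)),
        x.IsAmalgamation (P := (incl G).op ⋙ P) t ↔ x'.IsAmalgamation t := by
      intro t
      constructor
      · intro h W a ha
        change _ = P.map (twist W a.tw).op (x (Hom.map a) ha)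
        rw [← h (Hom.map a) ha]
        exact (map_map P (a := (incl G).map (Hom.map a)) (eq_twist_comp a).symm t).symm
      · intro h W f hf
        refine (h ((incl G).map f) hf).trans ?_
        change P.map (𝟙 _) _ = _
        rw [P.map_id]
        rfl
    exact ⟨t, (key t).2 ht, fun s hs => hu s ((key s).1 hs)⟩
  · intro hP X S hS x hx
    let x' : Presieve.FamilyOfElements ((incl G).op ⋙ P)
        (Sieve.functorPullback (X := X.base) (incl G) S).arrows := fun W f hf =>
      x ((incl G).map f) hf
    have hxs := (Presieve.compatible_iff_sieveCompatible x).1 hx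
    have hx' : x'.Compatible := by
      rw [Presieve.compatible_iff_sieveCompatible]
      intro W V f i hf
      have := hxs ((incl G).map f) ((incl G).map i) hf
      refine Eq.trans ?_ this
      change x ((incl G).map (i ≫ f)) _ = _
      congr 1
      exact CategoryTheory.Functor.map_comp _ _ _
    obtain ⟨t, ht, hu⟩ := hP _ hS x' hx'
    have key : ∀ t : P.obj (op X), x'.IsAmalgamation (P := (incl G).op ⋙ P) t ↔
        x.IsAmalgamation t := by
      intro t
      constructor
      · intro h W a ha
        have ha' : S ((incl G).map (Hom.map a)) := by
          have : (incl G).map (Hom.map a) = twist W (a.tw)⁻¹ ≫ a :=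
            Hom.ext (inv_mul_cancel a.tw).symm rfl
          rw [this]
          exact S.downward_closed ha _
        have h1 := h (Hom.map a) ha'
        change P.map ((incl G).map (Hom.map a)).op t = x _ ha' at h1
        have h2 := hxs ((incl G).map (Hom.map a)) (twist W a.tw) ha'
        rw [← h1] at h2
        refine (map_map P (a := (incl G).map (Hom.map a)) (eq_twist_comp a).symm t).symm.trans
          (h2.symm.trans ?_)
        congr 1
        exact (eq_twist_comp a).symm
      · intro h W f hf
        exact h ((incl G).map f) hf
    exact ⟨t, (key t).1 ht, fun s hs => hu s ((key s).2 hs)⟩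

end ActSite

namespace AbObject

open ClassifyingTopos ActSite

/-- The presheaf on the auxiliary site attached to an abelian group object. -/
def toPresheaf (A : AbObject G) : (ActSite G)ᵒᵖ ⥤ AddCommGrpCat.{u + 1} where
  obj X := AddCommGrpCat.of (A.sec X.unop.base)
  map a := AddCommGrpCat.ofHom ((A.actHom (ActSite.Hom.tw a.unop)).comp (A.res (ActSite.Hom.map a.unop)))
  map_id X := by
    ext s
    change A.act 1 (A.sheaf.obj.map (𝟙 _) s) = s
    rw [A.one_act, CategoryTheory.Functor.map_id]; rfl
  map_comp a b := by
    ext s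
    change A.act (_ * _) (A.sheaf.obj.map ((ActSite.Hom.map a.unop).op ≫ (ActSite.Hom.map b.unop).op) s) =
      A.act _ (A.sheaf.obj.map _ (A.act _ (A.sheaf.obj.map _ s)))
    rw [A.mul_act, A.map_act, CategoryTheory.Functor.map_comp]
    rfl

theorem isSheaf_toPresheaf (A : AbObject G) :
    Presheaf.IsSheaf (ActSite.topology G) A.toPresheaf := by
  rw [Presheaf.isSheaf_iff_isSheaf_forget _ _ (forget AddCommGrpCat.{u + 1}),
    isSheaf_iff_isSheaf_of_type, ActSite.isSheaf_iff]
  have h := (isSheaf_iff_isSheaf_of_type _ _).1 A.sheaf.property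
  let e : A.sheaf.obj ≅ (incl G).op ⋙ A.toPresheaf ⋙ forget AddCommGrpCat.{u + 1} :=
    NatIso.ofComponents (fun X => Iso.refl (A.sheaf.obj.obj X)) (by
      intro X Y f
      ext s
      exact (A.one_act _).symm)
  exact Presieve.isSheaf_iso _ e h

variable (G) in
/-- The functor from abelian group objects of `BG` to abelian sheaves on the auxiliary site. -/
def toSheaf : AbObject G ⥤ Sheaf (ActSite.topology G) AddCommGrpCat.{u + 1} where
  obj A := ⟨A.toPresheaf, A.isSheaf_toPresheaf⟩
  map {A B} f := ObjectProperty.homMk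
    { app := fun X => AddCommGrpCat.ofHom (secHom f X.unop.base)
      naturality := fun X Y a => by
        ext s
        change app (toBG f) (A.act _ (A.sheaf.obj.map _ s)) =
          B.act _ (B.sheaf.obj.map _ (app (toBG f) s))
        rw [app_act]
        exact congrArg _ (app_map (toBG f) _ s) }

instance : (toSheaf G).Faithful where
  map_injective {A B _ _} h := toBG_injective (hom_ext' fun {X} s =>
    ConcreteCategory.congr_hom
      (congrArg (fun φ : (toSheaf G).obj A ⟶ (toSheaf G).obj B =>
        φ.hom.app (op (⟨X⟩ : ActSite G))) h) s)

instance : (toSheaf G).Full where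
  map_surjective {A B} φ := by
    let ψ : ∀ X : AnMan K, A.sec X →+ B.sec X := fun X => (φ.hom.app (op (⟨X⟩ : ActSite G))).hom
    have hψ : ∀ {X Y : ActSite G} (a : Y ⟶ X) (s : A.sec X.base),
        ψ Y.base (A.act (ActSite.Hom.tw a) (A.sheaf.obj.map (ActSite.Hom.map a).op s)) =
          B.act (ActSite.Hom.tw a) (B.sheaf.obj.map (ActSite.Hom.map a).op (ψ X.base s)) :=
      fun a s => ConcreteCategory.congr_hom (φ.hom.naturality a.op) s
    let f : A ⟶ B :=
      ⟨homMk' (fun {X} s => ψ X s)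
        (fun {X Y} i s => by
          have := hψ ((incl G).map i) s
          change ψ Y (A.act 1 (A.sheaf.obj.map i.op s)) =
            B.act 1 (B.sheaf.obj.map i.op (ψ X s)) at this
          rwa [A.one_act, B.one_act] at this)
        (fun {X} g s => by
          have := hψ (twist (⟨X⟩ : ActSite G) g) s
          change ψ X (A.act g (A.sheaf.obj.map (𝟙 (op X)) s)) =
            B.act g (B.sheaf.obj.map (𝟙 (op X)) (ψ X s)) at this
          rw [CategoryTheory.Functor.map_id, CategoryTheory.Functor.map_id] at this
          exact this), fun {X} s t => _root_.map_add (ψ X) s t⟩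
    exact ⟨f, rfl⟩

/-- The object of `BG` attached to an abelian sheaf on the auxiliary site. -/
def ofSheafBG (P : Sheaf (ActSite.topology G) AddCommGrpCat.{u + 1}) : ClassifyingTopos G where
  sheaf := ⟨(incl G).op ⋙ P.obj ⋙ forget AddCommGrpCat.{u + 1}, by
    rw [isSheaf_iff_isSheaf_of_type, ← ActSite.isSheaf_iff (P.obj ⋙ forget AddCommGrpCat.{u + 1}),
      ← isSheaf_iff_isSheaf_of_type, ← Presheaf.isSheaf_iff_isSheaf_forget]
    exact P.property⟩
  act {X} g s := P.obj.map (twist (⟨X⟩ : ActSite G) g).op s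
  one_act s := by
    rw [twist_one, op_id, CategoryTheory.Functor.map_id]; rfl
  mul_act g h s := by
    rw [twist_mul, op_comp, CategoryTheory.Functor.map_comp]; rfl
  map_act {X Y} f g s := by
    exact (map_map' P.obj (a := twist ⟨X⟩ g) (b := (incl G).map f) (incl_comp_twist f g) s).trans
      (map_map' P.obj rfl s).symm

instance (P : Sheaf (ActSite.topology G) AddCommGrpCat.{u + 1}) (X : AnMan K) :
    AddCommGroup ((ofSheafBG P).sheaf.obj.obj (op X)) :=
  (inferInstance : AddCommGroup (P.obj.obj (op ((incl G).obj X))))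

/-- The abelian group object of `BG` attached to an abelian sheaf on the auxiliary site. -/
def ofSheaf (P : Sheaf (ActSite.topology G) AddCommGrpCat.{u + 1}) : AbObject G where
  toClassifyingTopos := ofSheafBG P
  addCommGroup _ := inferInstance
  map_add f s t := _root_.map_add (P.obj.map ((incl G).map f).op).hom s t
  act_add g s t := _root_.map_add (P.obj.map (twist _ g).op).hom s t

/-- Every abelian sheaf on the auxiliary site comes from an abelian group object of `BG`. -/
def toSheafOfSheaf (P : Sheaf (ActSite.topology G) AddCommGrpCat.{u + 1}) :
    (toSheaf G).obj (ofSheaf P) ≅ P :=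
  (fullyFaithfulSheafToPresheaf _ _).preimageIso
    (NatIso.ofComponents (fun X => AddEquiv.toAddCommGrpIso
        (X := AddCommGrpCat.of ((ofSheaf P).sec X.unop.base)) (Y := P.obj.obj X)
        (AddEquiv.refl (P.obj.obj X))) (by
      intro X Y a
      ext s
      exact map_map' P.obj (a := (incl G).map (ActSite.Hom.map a.unop))
        (b := twist Y.unop (ActSite.Hom.tw a.unop)) (eq_twist_comp a.unop).symm s))

instance : (toSheaf G).EssSurj where
  mem_essImage P := ⟨ofSheaf P, ⟨toSheafOfSheaf P⟩⟩

instance : (toSheaf G).IsEquivalence where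

instance : (toSheaf G).Additive where
  map_add := rfl

instance : Limits.HasFiniteProducts (AbObject G) :=
  ⟨fun _ => Adjunction.hasLimitsOfShape_of_equivalence (toSheaf G)⟩

noncomputable instance : Abelian (AbObject G) := abelianOfEquivalence (toSheaf G)

instance : EnoughInjectives (AbObject G) := by
  have : EssentiallySmall.{u + 1} (ActSite G) := inferInstance
  have : IsGrothendieckAbelian.{u + 1}
      (Sheaf (ActSite.topology G) AddCommGrpCat.{u + 1}) :=
    Sheaf.isGrothendieckAbelian_of_essentiallySmall _ _
  exact EnoughInjectives.of_equivalence (toSheaf G)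

end AbObject

namespace AbObject

open ClassifyingTopos

/-- The functors of sections `Γ(X, -) = Hom_BG(X, -)`, for varying objects `X` of `BG`. -/
def sections : (ClassifyingTopos G)ᵒᵖ ⥤ AbObject G ⥤ AddCommGrpCat.{u + 1} where
  obj X :=
    { obj := fun A => AddCommGrpCat.of (X.unop ⟶ A.toClassifyingTopos)
      map := fun f => AddCommGrpCat.ofHom (AddMonoidHom.mk' (fun s => s ≫ toBG f)
        (fun s t => hom_ext' fun _ => toBG_add f _ _))
      map_id := fun A => by
        ext s
        exact Category.comp_id s
      map_comp := fun f g => by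
        ext s
        exact (Category.assoc s (toBG f) (toBG g)).symm }
  map φ :=
    { app := fun A => AddCommGrpCat.ofHom (AddMonoidHom.mk' (fun s => φ.unop ≫ s)
        (fun s t => rfl))
      naturality := fun A B f => by
        ext s
        exact (Category.assoc φ.unop s (toBG f)).symm }
  map_id X := by
    ext A s
    exact Category.id_comp s
  map_comp φ ψ := by
    ext A s
    exact Category.assoc ψ.unop φ.unop s

instance (X : (ClassifyingTopos G)ᵒᵖ) : (sections.obj X : AbObject G ⥤ _).Additive where
  map_add := rfl

variable (G) in
/-- The global section functor `Γ = Hom_BG(*, -)` on abelian group objects of `BG`. -/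
def globalSections : AbObject G ⥤ AddCommGrpCat.{u + 1} := sections.obj (op (terminal G))

instance : (globalSections G).Additive := inferInstanceAs (sections.obj _).Additive

variable (G) in
/-- The cosimplicial abelian group `Γ(E_• G, A)`, functorially in `A`. -/
noncomputable def cosimplicialSections : AbObject G ⥤ CosimplicialObject AddCommGrpCat.{u + 1} :=
  ((simplicialE G).rightOp ⋙ sections).flip

variable (G) in
/-- The cohomology `H^n(Γ(E_• G, A))` of the cochain complex associated with the cosimplicial
abelian group `Γ(E_• G, A)`, functorially in `A`. -/
noncomputable def cochainCohomology (n : ℕ) : AbObject G ⥤ AddCommGrpCat.{u + 1} :=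
  cosimplicialSections G ⋙ AlgebraicTopology.alternatingCofaceMapComplex AddCommGrpCat.{u + 1} ⋙
    HomologicalComplex.homologyFunctor _ _ n

end AbObject

end ClassifyingTopos

/-! The functor `cochains G`, sending `A` to the complex of `Γ(E_•G, A)`, is a candidate for
computing the derived functors of its own `H^0`. This needs three facts: it is exact, its cohomology
in positive degrees vanishes on injectives, and its `H^0` is `Γ`.

Exactness: `G` acts freely on `E_pG` with quotient `G^p`, and `(1, g_1, …, g_p)` is a section of the
quotient map, so `Γ(E_pG, A) = A(G^p)` (`sectionsIso`). Over a complete nonarchimedean field every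
open cover of a manifold is refined by disjoint clopen sets. A section of a quotient sheaf therefore
lifts: local lifts on disjoint pieces glue without any compatibility (`secFunctor_map_surjective`).
Hence sections over a manifold are exact in the sheaf, and so is the complex, degree by degree.

Acyclicity: cochains are morphisms from the presheaves `ℤ[E_pG]` on the auxiliary site. Putting `1`
in front of a tuple contracts `ℤ[E_•G]` over each object of the site, so that complex of presheaves
is exact in positive degrees. An injective sheaf is injective as a presheaf, so mapping into it
preserves this exactness (`isZero_homology_cochains`).

Degree zero: a 0-cocycle takes the same value on any two sections of `E_0G`, so it comes from the
terminal object (`globalSectionsIso`).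

Dimension shifting along an injective resolution (`CochainComplex.nonempty_rightDerived_iso`) then
identifies `H^n` of the complex with the `n`-th right derived functor, naturally in `A`. -/

section ZeroDimensional

/-! ### Clopen refinements in locally ultrametrizable spaces -/

open Set Topology Metric

/-- Disjoint closed subsets of an ultrametric space are separated by a clopen subset. -/
theorem IsUltrametricDist.exists_isClopen_separating {Y : Type*} [PseudoMetricSpace Y]
    [IsUltrametricDist Y] {F H : Set Y} (hF : IsClosed F) (hH : IsClosed H) (h : Disjoint F H) :
    ∃ C : Set Y, IsClopen C ∧ F ⊆ C ∧ Disjoint C H := by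
  -- The union of all balls that meet `F` and miss `H`. It is closed because two balls are nested or
  -- disjoint: a ball missing `F` around a point outside `C` can neither contain nor be contained in
  -- a ball of the union.
  let C : Set Y := {z | ∃ y r, z ∈ ball y r ∧ Disjoint (ball y r) H ∧ (ball y r ∩ F).Nonempty}
  refine ⟨C, ⟨⟨?_⟩, ?_⟩, ?_, ?_⟩
  · rw [Metric.isOpen_iff]
    intro y hy
    by_cases hyF : y ∈ F
    · obtain ⟨r, hr, hb⟩ := Metric.isOpen_iff.1 hH.isOpen_compl y (h.notMem_of_mem_left hyF)
      exact absurd ⟨y, r, mem_ball_self hr, disjoint_left.2 hb, y, mem_ball_self hr, hyF⟩ hy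
    · obtain ⟨r, hr, hb⟩ := Metric.isOpen_iff.1 hF.isOpen_compl y hyF
      refine ⟨r, hr, ?_⟩
      rintro z hz ⟨y', r', hz', hd, w, hw, hwF⟩
      rcases IsUltrametricDist.ball_subset_trichotomy (x := y) (y := y') (r := r) (s := r') with
        h1 | h1 | h1
      · exact hy ⟨y', r', h1 (mem_ball_self hr), hd, w, hw, hwF⟩
      · exact hb (h1 hw) hwF
      · exact disjoint_left.1 h1 hz hz'
  · rw [Metric.isOpen_iff]
    rintro z ⟨y, r, hz, hd, hn⟩
    obtain ⟨ε, hε, hb⟩ := Metric.isOpen_iff.1 isOpen_ball z hz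
    exact ⟨ε, hε, fun w hw => ⟨y, r, hb hw, hd, hn⟩⟩
  · intro y hy
    obtain ⟨r, hr, hb⟩ := Metric.isOpen_iff.1 hH.isOpen_compl y (h.notMem_of_mem_left hy)
    exact ⟨y, r, mem_ball_self hr, disjoint_left.2 hb, y, mem_ball_self hr, hy⟩
  · rw [disjoint_left]
    rintro z ⟨y, r, hz, hd, -⟩ hzH
    exact disjoint_left.1 hd hz hzH

/-- A closed subset of an open ultrametrizable subset `U` has a clopen neighbourhood in `U`. -/
theorem exists_isClopen_between {X Z : Type*} [TopologicalSpace X] [NormalSpace X]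
    [PseudoMetricSpace Z] [IsUltrametricDist Z] {U F : Set X} (hU : IsOpen U) (hF : IsClosed F)
    (hFU : F ⊆ U) (f : X → Z) (hf : IsInducing (U.domRestrict f)) :
    ∃ C : Set X, IsClopen C ∧ F ⊆ C ∧ C ⊆ U := by
  -- Only `U` is ultrametrizable, and a clopen subset of `U` need not be closed in `X`. Keeping it
  -- inside `V` forces its closure in `X` to stay in `U`, where it is already closed.
  obtain ⟨V, hV, hFV, hVU⟩ := normal_exists_closure_subset hF hU hFU
  let := hf.comapPseudoMetricSpace
  have : IsUltrametricDist U := ⟨fun x y z =>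
    IsUltrametricDist.dist_triangle_max (f x) (f y) (f z)⟩
  obtain ⟨C, hC, hFC, hCV⟩ := IsUltrametricDist.exists_isClopen_separating
    (F := ((↑) : U → X) ⁻¹' F) (H := ((↑) : U → X) ⁻¹' Vᶜ)
    (hF.preimage continuous_subtype_val) (hV.isClosed_compl.preimage continuous_subtype_val)
    (disjoint_left.2 fun x hx hx' => hx' (hFV hx))
  have hCV' : ((↑) '' C : Set X) ⊆ V := by
    rintro _ ⟨x, hx, rfl⟩
    by_contra hxV
    exact disjoint_left.1 hCV hx hxV
  refine ⟨(↑) '' C, ⟨?_, hU.isOpenMap_subtype_val _ hC.isOpen⟩,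
    fun x hx => ⟨⟨x, hFU hx⟩, hFC hx, rfl⟩, by rintro _ ⟨x, -, rfl⟩; exact x.2⟩
  refine isClosed_of_closure_subset fun x hx => ?_
  have hxU : x ∈ U := hVU (closure_mono hCV' hx)
  refine ⟨⟨x, hxU⟩, ?_, rfl⟩
  rw [← hC.isClosed.closure_eq, closure_subtype]
  exact hx

/-- Open covers of a paracompact Hausdorff locally ultrametrizable space have refinements by
disjoint clopen subsets. -/
theorem exists_disjoint_isClopen_refinement {X Z : Type*} [TopologicalSpace X] [T2Space X]
    [ParacompactSpace X] [PseudoMetricSpace Z] [IsUltrametricDist Z] (W : X → Set X)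
    (hW : ∀ x, IsOpen (W x)) (hxW : ∀ x, x ∈ W x) (f : X → X → Z)
    (hf : ∀ x, IsInducing ((W x).domRestrict (f x))) :
    ∃ D : X → Set X, (∀ x, IsClopen (D x)) ∧ (∀ x, D x ⊆ W x) ∧
      Pairwise (Function.onFun Disjoint D) ∧ ⋃ x, D x = univ := by
  obtain ⟨V, hVo, hVc, hVf, hVW⟩ := precise_refinement W hW
    (iUnion_eq_univ_iff.2 fun x => ⟨x, hxW x⟩)
  obtain ⟨F, hFc, hFcl, hFV⟩ := exists_iUnion_eq_closed_subset hVo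
    (fun x => hVf.point_finite x) hVc
  have key : ∀ x, ∃ C : Set X, IsClopen C ∧ F x ⊆ C ∧ C ⊆ V x := fun x =>
    exists_isClopen_between (hVo x) (hFcl x) (hFV x) (f x)
      ((hf x).comp (IsEmbedding.inclusion (hVW x)).isInducing)
  choose C hC hFC hCV using key
  let r : X → X → Prop := WellOrderingRel
  -- Remove from each `C x` all earlier members for a well-ordering of the index set. The union
  -- removed is closed by local finiteness, and each point lies in `D x` for the least `x` with the
  -- point in `C x`.
  let D : X → Set X := fun x => C x \ ⋃ y : {y // r y x}, C y
  refine ⟨D, fun x => ?_, fun x => sdiff_subset.trans ((hCV x).trans (hVW x)), ?_, ?_⟩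
  · refine (hC x).diff ⟨?_, isOpen_iUnion fun y => (hC y).isOpen⟩
    exact ((hVf.subset hCV).comp_injective Subtype.val_injective).isClosed_iUnion
      fun y => (hC y).isClosed
  · intro x y hxy
    change Disjoint (D x) (D y)
    rw [disjoint_left]
    rintro z ⟨hx, hx'⟩ ⟨hy, hy'⟩
    rcases trichotomous_of WellOrderingRel x y with h | h | h
    · exact hy' (mem_iUnion.2 ⟨⟨x, h⟩, hx⟩)
    · exact hxy h
    · exact hx' (mem_iUnion.2 ⟨⟨y, h⟩, hy⟩)
  · refine iUnion_eq_univ_iff.2 fun z => ?_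
    have hz : {x | z ∈ C x}.Nonempty := by
      obtain ⟨x, hx⟩ := mem_iUnion.1 (hFc.ge (mem_univ z))
      exact ⟨x, hFC x hx⟩
    have hwf : WellFounded r := IsWellFounded.wf
    refine ⟨hwf.min _ hz, hwf.min_mem _ hz, ?_⟩
    rw [mem_iUnion]
    rintro ⟨⟨y, hy⟩, hzy⟩
    exact hwf.not_lt_min _ (show y ∈ {x | z ∈ C x} from hzy) hy

end ZeroDimensional

/-! ### Strict paracompactness of manifolds -/

namespace AnMan

open Set Topology

variable {K : Type u} [NontriviallyNormedField K] [IsUltrametricDist K] [CompleteSpace K]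

/-- Manifolds over a complete nonarchimedean field are strictly paracompact: open covers have
refinements by disjoint clopen subsets. -/
theorem exists_disjoint_isClopen_refinement (X : AnMan K) (W : X → Set X)
    (hW : ∀ x, IsOpen (W x)) (hxW : ∀ x, x ∈ W x) :
    ∃ D : X → Set X, (∀ x, IsClopen (D x)) ∧ (∀ x, D x ⊆ W x) ∧
      Pairwise (Function.onFun Disjoint D) ∧ ⋃ x, D x = univ := by
  -- The norm of the model space need not be ultrametric. Coordinates in a basis identify it
  -- topologically, `K` being complete, with a power of `K`, whose sup metric is ultrametric.
  let b := Module.finBasis K X.model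
  let e := fun x : X => chartAt X.model x
  obtain ⟨D, h1, h2, h3, h4⟩ := _root_.exists_disjoint_isClopen_refinement
    (fun x => W x ∩ (e x).source) (fun x => (hW x).inter (e x).open_source)
    (fun x => ⟨hxW x, mem_chart_source _ x⟩) (fun x y => b.equivFunL (e x y)) (fun x => by
      refine b.equivFunL.toHomeomorph.isInducing.comp ?_
      exact ((e x).isOpenEmbedding_restrict.isInducing).comp
        (IsEmbedding.inclusion (inter_subset_right (s := W x))).isInducing)
  exact ⟨D, h1, fun x => (h2 x).trans inter_subset_left, h3, h4⟩

end AnMan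

/-! ### Dimension shifting for exact functors to complexes -/

section DimensionShifting

open Limits

variable {C D : Type*} [Category* C] [Category* D] [Abelian C] [Abelian D]

-- Naturality descends along an epimorphism: if `e` is defined by factoring `b` through an
-- epimorphism `d`, then `e` is natural as soon as `d` and `b` are.
omit [Abelian C] in
theorem CategoryTheory.comp_eq_comp_of_epi {X₁ X₂ Y₁ Y₂ Z₁ Z₂ : C} {d₁ : X₁ ⟶ Y₁} [Epi d₁]
    {e₁ : Y₁ ⟶ Z₁} {b₁ : X₁ ⟶ Z₁} (h₁ : d₁ ≫ e₁ = b₁) {d₂ : X₂ ⟶ Y₂} {e₂ : Y₂ ⟶ Z₂}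
    {b₂ : X₂ ⟶ Z₂} (h₂ : d₂ ≫ e₂ = b₂) {x : X₁ ⟶ X₂} {y : Y₁ ⟶ Y₂} {z : Z₁ ⟶ Z₂}
    (hd : d₁ ≫ y = x ≫ d₂) (hb : x ≫ b₂ = b₁ ≫ z) : y ≫ e₂ = e₁ ≫ z := by
  rw [← cancel_epi d₁, ← Category.assoc, hd, Category.assoc, h₂, hb, ← h₁, Category.assoc]

omit [Abelian C] in
theorem CategoryTheory.comp_eq_comp_of_mono {X₁ X₂ Y₁ Y₂ Z₁ Z₂ : C} {c₁ : X₁ ⟶ Y₁}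
    {i₁ : Y₁ ⟶ Z₁} {t₁ : X₁ ⟶ Z₁} (h₁ : c₁ ≫ i₁ = t₁) {c₂ : X₂ ⟶ Y₂} {i₂ : Y₂ ⟶ Z₂} [Mono i₂]
    {t₂ : X₂ ⟶ Z₂} (h₂ : c₂ ≫ i₂ = t₂) {x : X₁ ⟶ X₂} {y : Y₁ ⟶ Y₂} {z : Z₁ ⟶ Z₂}
    (hi : y ≫ i₂ = i₁ ≫ z) (ht : x ≫ t₂ = t₁ ≫ z) : x ≫ c₂ = c₁ ≫ y := by
  rw [← cancel_mono i₂, Category.assoc, h₂, ht, ← h₁, Category.assoc, Category.assoc, hi]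

omit [Abelian C] in
theorem CategoryTheory.comp_eq_comp_of_squares {X₁ X₂ Y₁ Y₂ Z₁ Z₂ : C} {a₁ : X₁ ⟶ Y₁}
    {b₁ : Y₁ ⟶ Z₁} {a₂ : X₂ ⟶ Y₂} {b₂ : Y₂ ⟶ Z₂} {x : X₁ ⟶ X₂} {y : Y₁ ⟶ Y₂} {z : Z₁ ⟶ Z₂}
    (ha : x ≫ a₂ = a₁ ≫ y) (hb : y ≫ b₂ = b₁ ≫ z) : x ≫ a₂ ≫ b₂ = (a₁ ≫ b₁) ≫ z := by
  rw [← Category.assoc, ha, Category.assoc, hb, Category.assoc]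

/-- A complex of injective objects that is exact in positive degrees. -/
structure CochainComplex.IsInjectiveResolution (J : CochainComplex C ℕ) : Prop where
  injective : ∀ n, Injective (J.X n)
  exactAt : ∀ n, J.ExactAt (n + 1)

/-- The short complex `Z^q ⟶ J^q ⟶ Z^{q+1}`. -/
noncomputable abbrev CochainComplex.cyclesShortComplex (J : CochainComplex C ℕ) (q : ℕ) :
    ShortComplex C :=
  ShortComplex.mk (J.iCycles q) (J.toCycles q (q + 1)) (by
    rw [← cancel_mono (J.iCycles (q + 1))]; simp)

/-- Cycles are the kernel of the differential, which gives the left half. The cokernel of `J^q ⟶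
Z^{q+1}` is `H^{q+1}`, which vanishes, so this map is epi. -/
theorem CochainComplex.shortExact_cyclesShortComplex {J : CochainComplex C ℕ} (q : ℕ)
    (hJ : J.ExactAt (q + 1)) : (J.cyclesShortComplex q).ShortExact where
  exact := by
    refine ShortComplex.exact_of_f_is_kernel _ (KernelFork.IsLimit.ofι _ _
      (fun k hk => J.liftCycles k (q + 1) (by simp) ?_) (fun k hk => by simp)
      (fun k hk m hm => ?_))
    · rw [← J.toCycles_i, reassoc_of% hk, zero_comp]
    · rw [← cancel_mono (J.iCycles q)]
      simpa using hm
  mono_f := by dsimp; infer_instance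
  epi_g := by
    rw [Preadditive.epi_iff_cancel_zero]
    intro Z z hz
    have h := J.homologyIsCokernel q (q + 1) (by simp)
    have hh : IsZero (J.homology (q + 1)) := hJ.isZero_homology
    obtain ⟨l, hl⟩ := CokernelCofork.IsColimit.desc' h z hz
    rw [← hl, hh.eq_of_src l 0, comp_zero]

/-- The morphism between the short complexes `Z^q ⟶ J^q ⟶ Z^{q+1}` induced by a morphism
of complexes. -/
noncomputable abbrev CochainComplex.cyclesShortComplexMap {J L : CochainComplex C ℕ} (f : J ⟶ L)
    (q : ℕ) : J.cyclesShortComplex q ⟶ L.cyclesShortComplex q where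
  τ₁ := HomologicalComplex.cyclesMap f q
  τ₂ := f.f q
  τ₃ := HomologicalComplex.cyclesMap f (q + 1)
  comm₂₃ := by
    rw [← cancel_mono (L.iCycles (q + 1))]; simp

section LeftExact

variable (T : C ⥤ D) [T.Additive] [PreservesFiniteLimits T] (J : CochainComplex C ℕ) (q : ℕ)

/-- A left exact functor commutes with cycles. -/
noncomputable def CochainComplex.mapCyclesIso :
    T.obj (J.cycles q) ≅ ((T.mapHomologicalComplex _).obj J).cycles q :=
  (KernelFork.mapIsLimit _ (J.cyclesIsKernel q (q + 1) (by simp)) T).conePointUniqueUpToIso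
    (((T.mapHomologicalComplex _).obj J).cyclesIsKernel q (q + 1) (by simp))

theorem CochainComplex.mapCyclesIso_hom_iCycles :
    (J.mapCyclesIso T q).hom ≫ ((T.mapHomologicalComplex _).obj J).iCycles q =
      T.map (J.iCycles q) :=
  IsLimit.conePointUniqueUpToIso_hom_comp _ _ WalkingParallelPair.zero

theorem CochainComplex.mapCyclesIso_hom_naturality {J L : CochainComplex C ℕ} (f : J ⟶ L) :
    T.map (HomologicalComplex.cyclesMap f q) ≫ (L.mapCyclesIso T q).hom =
      (J.mapCyclesIso T q).hom ≫
        HomologicalComplex.cyclesMap ((T.mapHomologicalComplex _).map f) q := by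
  refine comp_eq_comp_of_mono (J.mapCyclesIso_hom_iCycles T q) (L.mapCyclesIso_hom_iCycles T q)
    (HomologicalComplex.cyclesMap_i _ _) ?_
  refine (T.map_comp _ _).symm.trans ((congrArg T.map ?_).trans (T.map_comp _ _))
  exact HomologicalComplex.cyclesMap_i f q

theorem CochainComplex.map_toCycles_comp_mapCyclesIso_hom (q' : ℕ) :
    T.map (J.toCycles q q') ≫ (J.mapCyclesIso T q').hom =
      ((T.mapHomologicalComplex _).obj J).toCycles q q' := by
  refine (cancel_mono (((T.mapHomologicalComplex _).obj J).iCycles q')).1 ?_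
  refine (Category.assoc _ _ _).trans ((congrArg (T.map (J.toCycles q q') ≫ ·)
    (J.mapCyclesIso_hom_iCycles T q')).trans ?_)
  refine (T.map_comp _ _).symm.trans ((congrArg T.map (J.toCycles_i q q')).trans ?_)
  exact (HomologicalComplex.toCycles_i ((T.mapHomologicalComplex _).obj J) q q').symm

/-- The projection of `T (Z^q)` to the cohomology of the complex `T J`. -/
noncomputable def CochainComplex.mapCyclesπ :
    T.obj (J.cycles q) ⟶ ((T.mapHomologicalComplex _).obj J).homology q :=
  (J.mapCyclesIso T q).hom ≫ HomologicalComplex.homologyπ _ q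

instance : Epi (J.mapCyclesπ T q) := by
  unfold CochainComplex.mapCyclesπ
  infer_instance

theorem CochainComplex.mapCyclesπ_naturality {J L : CochainComplex C ℕ} (f : J ⟶ L) :
    T.map (HomologicalComplex.cyclesMap f q) ≫ L.mapCyclesπ T q =
      J.mapCyclesπ T q ≫
        HomologicalComplex.homologyMap ((T.mapHomologicalComplex _).map f) q := by
  simp only [mapCyclesπ, Category.assoc, HomologicalComplex.homologyπ_naturality]
  rw [reassoc_of% mapCyclesIso_hom_naturality]

theorem CochainComplex.map_toCycles_mapCyclesπ :
    T.map (J.toCycles q (q + 1)) ≫ J.mapCyclesπ T (q + 1) = 0 := by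
  refine (Category.assoc _ _ _).symm.trans ((congrArg
    (· ≫ ((T.mapHomologicalComplex _).obj J).homologyπ (q + 1))
    (J.map_toCycles_comp_mapCyclesIso_hom T q (q + 1))).trans ?_)
  exact HomologicalComplex.toCycles_comp_homologyπ _ _ _

/-- Left exactness makes `T (Z^{q+1})` the cycles of `T J`, so `H^{q+1}(T J)` is the cokernel of `T
(J^q) ⟶ T (Z^{q+1})`. This presentation is later matched with the one from the long exact sequence.
-/
theorem CochainComplex.exact_map_toCycles_mapCyclesπ :
    (ShortComplex.mk _ _ (J.map_toCycles_mapCyclesπ T q)).Exact := by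
  let J' := (T.mapHomologicalComplex _).obj J
  have h : (ShortComplex.mk _ _ (J'.toCycles_comp_homologyπ q (q + 1))).Exact :=
    ShortComplex.exact_of_g_is_cokernel _ (J'.homologyIsCokernel q (q + 1) (by simp))
  refine ShortComplex.exact_of_iso (S₁ := ShortComplex.mk _ _
    (J'.toCycles_comp_homologyπ q (q + 1))) (ShortComplex.isoMk (Iso.refl (J'.X q))
    (J.mapCyclesIso T (q + 1)).symm (Iso.refl (J'.homology (q + 1))) ?_ ?_) h
  · refine (Category.id_comp _).trans ?_
    exact ((Iso.comp_inv_eq _).2 (J.map_toCycles_comp_mapCyclesIso_hom T q (q + 1)).symm).symm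
  · exact (Iso.inv_hom_id_assoc _ _).trans (Category.comp_id _).symm

end LeftExact

variable (F : C ⥤ CochainComplex D ℕ)

/-- In degree zero nothing is divided out, so `H^0` is a subobject of the degree-zero term and
inherits monomorphisms from it. Exactness in the middle is part of the long exact sequence. -/
theorem CochainComplex.preservesFiniteLimits_homologyFunctor_zero [F.Additive]
    (hF : ∀ S : ShortComplex C, S.ShortExact → (S.map F).ShortExact) :
    PreservesFiniteLimits (F ⋙ HomologicalComplex.homologyFunctor D (ComplexShape.up ℕ) 0) := by
  have : (F ⋙ HomologicalComplex.homologyFunctor D (ComplexShape.up ℕ) 0).Additive :=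
    inferInstance
  refine ((Functor.preservesFiniteLimits_tfae _).out 0 3).1 fun S hS => ?_
  have h := hF S hS
  refine ⟨h.homology_exact₂ 0, ?_⟩
  change Mono (HomologicalComplex.homologyMap (F.map S.f) 0)
  have : Mono (F.map S.f) := h.mono_f
  have : Mono ((F.map S.f).f 0) := inferInstance
  have h1 : HomologicalComplex.homologyMap (F.map S.f) 0 =
      ((F.obj S.X₁).isoHomologyπ₀).inv ≫ HomologicalComplex.cyclesMap (F.map S.f) 0 ≫
      ((F.obj S.X₂).isoHomologyπ₀).hom := by
    rw [← cancel_epi ((F.obj S.X₁).isoHomologyπ₀).hom]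
    simp
  have h2 : Mono (HomologicalComplex.cyclesMap (F.map S.f) 0) := by
    have : Mono (HomologicalComplex.cyclesMap (F.map S.f) 0 ≫ (F.obj S.X₂).iCycles 0) := by
      rw [HomologicalComplex.cyclesMap_i]
      infer_instance
    exact mono_of_mono _ ((F.obj S.X₂).iCycles 0)
  rw [h1]
  infer_instance

variable [F.Additive] (hF : ∀ S : ShortComplex C, S.ShortExact → (S.map F).ShortExact)
  (hinj : ∀ (I : C) [Injective I] (n : ℕ), IsZero ((F.obj I).homology (n + 1)))

include hF hinj in
/-- Dimension shifting along an injective resolution, naturally in the resolution. -/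
theorem CochainComplex.exists_dimensionShift (n : ℕ) :
    ∀ q m : ℕ, q + n = m →
    ∃ e : ∀ J : CochainComplex C ℕ, J.IsInjectiveResolution →
      ((F.obj (J.cycles q)).homology (n + 1) ≅
        (((F ⋙ HomologicalComplex.homologyFunctor D (ComplexShape.up ℕ) 0).mapHomologicalComplex
          _).obj J).homology (m + 1)),
      ∀ (J L : CochainComplex C ℕ) (hJ : J.IsInjectiveResolution)
        (hL : L.IsInjectiveResolution) (f : J ⟶ L),
        HomologicalComplex.homologyMap (F.map (HomologicalComplex.cyclesMap f q)) (n + 1) ≫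
            (e L hL).hom =
          (e J hJ).hom ≫ HomologicalComplex.homologyMap
            (((F ⋙ HomologicalComplex.homologyFunctor D (ComplexShape.up ℕ)
              0).mapHomologicalComplex _).map f) (m + 1) := by
  have := preservesFiniteLimits_homologyFunctor_zero F hF
  have hS : ∀ (J : CochainComplex C ℕ) (hJ : J.IsInjectiveResolution) (q : ℕ),
    ((J.cyclesShortComplex q).map F).ShortExact := fun J hJ q =>
      hF _ (shortExact_cyclesShortComplex q (hJ.exactAt q))
  have nat : ∀ (J L : CochainComplex C ℕ) (hJ : J.IsInjectiveResolution)
      (hL : L.IsInjectiveResolution) (f : J ⟶ L) (q n : ℕ),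
      (hS J hJ q).δ n (n + 1) rfl ≫
        HomologicalComplex.homologyMap (F.map (HomologicalComplex.cyclesMap f q)) (n + 1) =
      HomologicalComplex.homologyMap (F.map (HomologicalComplex.cyclesMap f (q + 1))) n ≫
        (hS L hL q).δ n (n + 1) rfl := fun J L hJ hL f q n =>
    HomologicalComplex.HomologySequence.δ_naturality
      (F.mapShortComplex.map (cyclesShortComplexMap f q)) _ _ n (n + 1) rfl
  -- The step passes from `q` to `q + 1`, so `q` stays general, and `m` is tied to `q + n` by an
  -- equation to avoid transport. The isomorphisms are chosen for all resolutions at once so that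
  -- naturality makes sense.
  induction n with
  | zero =>
    rintro q _ rfl
    let T := F ⋙ HomologicalComplex.homologyFunctor D (ComplexShape.up ℕ) 0
    -- Since `H^1(F J^q) = 0`, the connecting map exhibits `H^1(F Z^q)` as the cokernel of `T (J^q)
    -- ⟶ T (Z^{q+1})`, which is also `H^{q+1}(T J)`.
    have hepi : ∀ (J : CochainComplex C ℕ) (hJ : J.IsInjectiveResolution),
        Epi ((hS J hJ q).δ 0 1 rfl) := fun J hJ => by
      have := hJ.injective q
      exact (hS J hJ q).epi_δ 0 1 rfl (hinj (J.X q) 0)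
    let e : ∀ (J : CochainComplex C ℕ) (hJ : J.IsInjectiveResolution),
        (F.obj (J.cycles q)).homology 1 ≅ ((T.mapHomologicalComplex _).obj J).homology (q + 1) :=
      fun J hJ => by
        have := hepi J hJ
        exact ((hS J hJ q).homology_exact₃ 0 1 rfl).gIsCokernel.coconePointUniqueUpToIso
          (J.exact_map_toCycles_mapCyclesπ T q).gIsCokernel
    have he : ∀ (J : CochainComplex C ℕ) (hJ : J.IsInjectiveResolution),
        (hS J hJ q).δ 0 1 rfl ≫ (e J hJ).hom = J.mapCyclesπ T (q + 1) := fun J hJ => by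
      have := hepi J hJ
      exact IsColimit.comp_coconePointUniqueUpToIso_hom
        ((hS J hJ q).homology_exact₃ 0 1 rfl).gIsCokernel
        (J.exact_map_toCycles_mapCyclesπ T q).gIsCokernel WalkingParallelPair.one
    refine ⟨e, fun J L hJ hL f => ?_⟩
    have := hepi J hJ
    exact comp_eq_comp_of_epi (he J hJ) (he L hL) (nat J L hJ hL f q 0)
      (mapCyclesπ_naturality T (q + 1) f)
  | succ n ih =>
    rintro q _ rfl
    obtain ⟨e, he⟩ := ih (q + 1) (q + (n + 1)) (by omega)
    -- The cohomology of `F J^q` vanishes in degrees `n + 1` and `n + 2`, so the connecting map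
    -- `H^{n+1}(F Z^{q+1}) ⟶ H^{n+2}(F Z^q)` is an isomorphism.
    have hi : ∀ (J : CochainComplex C ℕ) (hJ : J.IsInjectiveResolution),
        IsIso ((hS J hJ q).δ (n + 1) (n + 1 + 1) rfl) := fun J hJ => by
      have := hJ.injective q
      exact (hS J hJ q).isIso_δ (n + 1) (n + 1 + 1) rfl (hinj (J.X q) n) (hinj (J.X q) (n + 1))
    have hepi : ∀ (J : CochainComplex C ℕ) (hJ : J.IsInjectiveResolution),
        Epi ((hS J hJ q).δ (n + 1) (n + 1 + 1) rfl) := fun J hJ => by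
      have := hi J hJ
      infer_instance
    let e' := fun (J : CochainComplex C ℕ) (hJ : J.IsInjectiveResolution) =>
      (@asIso _ _ _ _ _ (hi J hJ)).symm ≪≫ e J hJ
    have he' : ∀ (J : CochainComplex C ℕ) (hJ : J.IsInjectiveResolution),
        (hS J hJ q).δ (n + 1) (n + 1 + 1) rfl ≫ (e' J hJ).hom = (e J hJ).hom := fun J hJ => by
      have := hi J hJ
      exact IsIso.hom_inv_id_assoc ((hS J hJ q).δ (n + 1) (n + 1 + 1) rfl) _
    refine ⟨e', fun J L hJ hL f => ?_⟩
    have := hepi J hJ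
    exact comp_eq_comp_of_epi (he' J hJ) (he' L hL) (nat J L hJ hL f q (n + 1))
      (he J L hJ hL f)

include hF hinj in
/-- The cohomology of an exact functor to complexes that is acyclic on injective objects is the
right derived functor of its `H^0`. -/
theorem CochainComplex.nonempty_rightDerived_iso [EnoughInjectives C] (n : ℕ) :
    Nonempty ((F ⋙ HomologicalComplex.homologyFunctor D (ComplexShape.up ℕ) 0).rightDerived n ≅
      F ⋙ HomologicalComplex.homologyFunctor D (ComplexShape.up ℕ) n) := by
  have := preservesFiniteLimits_homologyFunctor_zero F hF
  let T := F ⋙ HomologicalComplex.homologyFunctor D (ComplexShape.up ℕ) 0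
  cases n with
  | zero => exact ⟨T.rightDerivedZeroIsoSelf⟩
  | succ n =>
    -- Taking `q = 0` is what is needed, because `A` is the object of 0-cycles of its injective
    -- resolution (`z` below).
    obtain ⟨e, he⟩ := exists_dimensionShift F hF hinj n 0 n (zero_add n)
    let I : ∀ A : C, InjectiveResolution A := fun A => injectiveResolution A
    have hI : ∀ A : C, (I A).cocomplex.IsInjectiveResolution := fun A =>
      ⟨(I A).injective, (I A).cocomplex_exactAt_succ⟩
    let z : ∀ A : C, A ≅ (I A).cocomplex.cycles 0 := fun A =>
      (I A).isLimitKernelFork.conePointUniqueUpToIso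
        ((I A).cocomplex.cyclesIsKernel 0 1 (by simp))
    have hz : ∀ A : C, (z A).hom ≫ (I A).cocomplex.iCycles 0 = (I A).ι.f 0 := fun A =>
      IsLimit.conePointUniqueUpToIso_hom_comp _ _ WalkingParallelPair.zero
    have hzn : ∀ {A B : C} (f : A ⟶ B), (z A).hom ≫
        HomologicalComplex.cyclesMap (InjectiveResolution.desc f (I B) (I A)) 0 =
          f ≫ (z B).hom := fun {A B} f => by
      rw [← cancel_mono ((I B).cocomplex.iCycles 0), Category.assoc,
        HomologicalComplex.cyclesMap_i, ← Category.assoc, hz, Category.assoc, hz]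
      exact InjectiveResolution.desc_commutes_zero f (I B) (I A)
    let T' := F ⋙ HomologicalComplex.homologyFunctor D (ComplexShape.up ℕ) (n + 1)
    refine ⟨Iso.symm (NatIso.ofComponents (fun A =>
      T'.mapIso (z A) ≪≫ e _ (hI A) ≪≫ ((I A).isoRightDerivedObj T (n + 1)).symm) ?_)⟩
    intro A B f
    have h1 := InjectiveResolution.isoRightDerivedObj_inv_naturality f (I A) (I B)
      (InjectiveResolution.desc f (I B) (I A)) (InjectiveResolution.desc_commutes_zero f _ _)
      T (n + 1)
    have h2 := he _ _ (hI A) (hI B) (InjectiveResolution.desc f (I B) (I A))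
    have h3 : T'.map f ≫ T'.map (z B).hom = T'.map (z A).hom ≫
        T'.map (HomologicalComplex.cyclesMap (InjectiveResolution.desc f (I B) (I A)) 0) := by
      rw [← T'.map_comp, ← T'.map_comp, hzn]
    exact comp_eq_comp_of_squares h3 (comp_eq_comp_of_squares h2 h1.symm)

end DimensionShifting

/-! ### Gluing along disjoint covers -/

namespace AnMan

open Set Topology

variable {K : Type u} [NontriviallyNormedField K]

/-- Sections of a sheaf over disjoint clopen submanifolds covering `X` glue. -/
theorem exists_unique_glue_of_isClopen {P : (AnMan K)ᵒᵖ ⥤ Type (u + 1)}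
    (hP : Presieve.IsSheaf (topology K) P) {X : AnMan K} {ι : Type*} (Y : ι → AnMan K)
    (j : ∀ i, Y i ⟶ X) (hj : ∀ i, IsOpenImmersion (j i))
    (hd : Pairwise (Function.onFun Disjoint fun i => range (j i)))
    (hc : ∀ x : X, ∃ i, x ∈ range (j i)) (t : ∀ i, P.obj (op (Y i))) :
    ∃! s : P.obj (op X), ∀ i, P.map (j i).op s = t i := by
  have hs : Presieve.IsSheafFor P (Presieve.ofArrows Y j) := by
    rw [Presieve.isSheafFor_iff_generate]
    refine hP _ fun x => ?_
    obtain ⟨i, hi⟩ := hc x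
    exact ⟨Y i, j i, Sieve.le_generate _ _ _ (Presieve.ofArrows.mk i), hj i, hi⟩
  refine (Presieve.isSheafFor_arrows_iff _ _).1 hs t ?_
  intro i i' Z g g' h
  by_cases hii : i = i'
  · subst hii
    have : g = g' := hom_ext fun z => (hj i).1 (DFunLike.congr_fun h z)
    rw [this]
  -- Distinct pieces meet only in an empty manifold, which is covered by the empty sieve, so any two
  -- sections over it agree.
  · have hZ : ∀ z : Z, False := fun z =>
      disjoint_left.1 (hd hii) ⟨g z, rfl⟩ ⟨g' z, (DFunLike.congr_fun h z).symm⟩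
    exact ((hP ⊥ fun z => (hZ z).elim).isSeparatedFor).ext fun _ _ hf => hf.elim

variable [IsUltrametricDist K] [CompleteSpace K]

/-- Every open covering of a manifold is refined by disjoint open immersions. -/
theorem exists_disjoint_openImmersions {X : AnMan K} (S : Sieve X) (hS : S ∈ topology K X) :
    ∃ (Y : X → AnMan K) (j : ∀ x, Y x ⟶ X), (∀ x, S (j x)) ∧ (∀ x, IsOpenImmersion (j x)) ∧
      Pairwise (Function.onFun Disjoint fun x => range (j x)) ∧
      ∀ x : X, ∃ i, x ∈ range (j i) := by
  choose Y f hSf hf hx using hS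
  obtain ⟨D, hD, hDf, hd, hc⟩ := exists_disjoint_isClopen_refinement X (fun x => range (f x))
    (fun x => (hf x).2.isOpen_range) hx
  let V : X → TopologicalSpace.Opens X := fun x => ⟨D x, (hD x).isOpen⟩
  -- Here closedness of the pieces matters: an arbitrary open subset need not be paracompact, hence
  -- need not be a manifold.
  have hV : ∀ x, ParacompactSpace (V x) := fun x =>
    (hD x).isClosed.isClosedEmbedding_subtypeVal.paracompactSpace
  have hr : ∀ x, range (X.opensVal (V x)) = D x := fun x => Subtype.range_val
  refine ⟨fun x => X.opens (V x), fun x => X.opensVal (V x), fun x => ?_,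
    fun x => isOpenImmersion_opensVal X (V x), fun x y hxy => ?_, fun x => ?_⟩
  · obtain ⟨h, hh⟩ := (hf x).lift (X.opensVal (V x))
      (fun z => hDf x ((hr x).subset (mem_range_self z)))
    change S (X.opensVal (V x))
    rw [← hh]
    exact S.downward_closed (hSf x) h
  · change Disjoint (range _) (range _)
    rw [hr, hr]
    exact hd hxy
  · obtain ⟨i, hi⟩ := mem_iUnion.1 (hc.ge (mem_univ x))
    exact ⟨i, (hr i).ge hi⟩

end AnMan

/-! ### Exactness of sections and of the cochain functor -/

namespace AbObject

open ClassifyingTopos ActSite Limits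

variable {K : Type u} [NontriviallyNormedField K]
variable {G : AnMan K} [Group G] [LieGroup 𝓘(K, G.model) ω G]

variable (G) in
/-- The functor of sections over a manifold. -/
noncomputable def secFunctor (X : AnMan K) : AbObject G ⥤ AddCommGrpCat.{u + 1} :=
  toSheaf G ⋙ sheafToPresheaf _ _ ⋙ (evaluation _ _).obj (op ⟨X⟩)

instance (X : AnMan K) : (secFunctor G X).Additive where
  map_add := rfl

instance (X : AnMan K) : PreservesFiniteLimits (secFunctor G X) := by
  unfold secFunctor
  infer_instance

/-- An epimorphism of sheaves is surjective locally. After refining to disjoint pieces, arbitrarily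
chosen local lifts glue, and the glued section has the right image because it does so on every
piece. -/
theorem secFunctor_map_surjective [IsUltrametricDist K] [CompleteSpace K] (X : AnMan K)
    {A B : AbObject G} (g : A ⟶ B) [Epi g] : Function.Surjective (secHom g X) := by
  intro s
  have hepi : Sheaf.IsLocallySurjective ((toSheaf G).map g) := by
    rw [Sheaf.isLocallySurjective_iff_epi']
    infer_instance
  have hS := Presheaf.imageSieve_mem (ActSite.topology G) ((toSheaf G).map g).hom
    (U := op (⟨X⟩ : ActSite G)) s
  -- A covering sieve of the auxiliary site is by definition one whose pullback to manifolds covers.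
  -- The maps `j` enter it with trivial twist, whence `one_act` below.
  obtain ⟨Y, j, hj, hji, hd, hc⟩ := exists_disjoint_openImmersions _ hS
  have ht : ∀ x, ∃ t : A.sec (Y x), app (toBG g) t = B.sheaf.obj.map (j x).op s := fun x => by
    obtain ⟨t, ht⟩ := hj x
    exact ⟨t, ht.trans (B.one_act _)⟩
  choose t ht using ht
  have hA := (isSheaf_iff_isSheaf_of_type _ _).1 A.sheaf.property
  have hB := (isSheaf_iff_isSheaf_of_type _ _).1 B.sheaf.property
  obtain ⟨a, ha, -⟩ := exists_unique_glue_of_isClopen hA Y j hji hd hc t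
  refine ⟨a, (exists_unique_glue_of_isClopen hB Y j hji hd hc
    (fun x => B.sheaf.obj.map (j x).op s)).unique (fun x => ?_) (fun _ => rfl)⟩
  change B.sheaf.obj.map (j x).op (app (toBG g) a) = _
  rw [← app_map, ha, ht]

theorem exact_mono_map_secFunctor (X : AnMan K) :
    ∀ S : ShortComplex (AbObject G), S.ShortExact →
      (S.map (secFunctor G X)).Exact ∧ Mono ((secFunctor G X).map S.f) :=
  (((secFunctor G X).preservesFiniteLimits_tfae).out 0 3).2
    (inferInstance : PreservesFiniteLimits (secFunctor G X))

/-- Taking sections over a manifold is exact. -/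
theorem shortExact_map_secFunctor [IsUltrametricDist K] [CompleteSpace K] (X : AnMan K)
    {S : ShortComplex (AbObject G)} (hS : S.ShortExact) :
    (S.map (secFunctor G X)).ShortExact where
  exact := (exact_mono_map_secFunctor X S hS).1
  mono_f := (exact_mono_map_secFunctor X S hS).2
  epi_g := by
    have := hS.epi_g
    exact (AddCommGrpCat.epi_iff_surjective _).2 (secFunctor_map_surjective X S.g)

section Torsor

variable (p : SimplexCategoryᵒᵖ)

/-- The section `(1, g_1, …, g_p)` of `y(E_p G)` over `G ^ p`. -/
noncomputable def universalSection :
    (EObj (G := G) p).sheaf.obj.obj (op (power G (Fin p.unop.len))) :=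
  ULift.up (powerLift (Fin.cons (α := fun _ => power G (Fin p.unop.len) ⟶ G) 1 powerProj))

/-- The classifying map `(g_0, …, g_p) ↦ (g_0⁻¹ g_1, …, g_0⁻¹ g_p)` of a section of
`y(E_p G)`. -/
noncomputable def quotientMap {X : AnMan K} (x : (EObj (G := G) p).sheaf.obj.obj (op X)) :
    X ⟶ power G (Fin p.unop.len) :=
  powerLift fun i => (x.down ≫ powerProj (0 : Fin (p.unop.len + 1)))⁻¹ *
    (x.down ≫ powerProj i.succ)

/-- This is `(g_0, …, g_p) = g_0 · (1, g_0⁻¹ g_1, …, g_0⁻¹ g_p)`. An equivariant morphism out of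
`y(E_p G)` is thus determined by its value on the universal section. -/
theorem act_map_universalSection {X : AnMan K} (x : (EObj (G := G) p).sheaf.obj.obj (op X)) :
    (EObj (G := G) p).act (x.down ≫ powerProj (0 : Fin (p.unop.len + 1)))
      ((EObj (G := G) p).sheaf.obj.map (quotientMap p x).op (universalSection p)) = x := by
  refine ULift.ext _ _ (power_ext fun i => ?_)
  change (x.down ≫ powerProj 0) * (quotientMap p x ≫
    (Fin.cons (α := fun _ => power G (Fin p.unop.len) ⟶ G) 1 powerProj i)) = x.down ≫ powerProj i
  refine Fin.cases ?_ (fun i => ?_) i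
  · exact mul_one (x.down ≫ powerProj (0 : Fin (p.unop.len + 1)))
  · exact mul_inv_cancel_left (x.down ≫ powerProj (0 : Fin (p.unop.len + 1))) _

/-- `Γ(y(E_p G), A) = A(G ^ p)`, since `G` acts freely on `E_p G` with quotient `G ^ p`. -/
noncomputable def sectionsEquiv (A : AbObject G) :
    (EObj (G := G) p ⟶ A.toClassifyingTopos) ≃+ A.sec (power G (Fin p.unop.len)) where
  toFun ψ := app ψ (universalSection p)
  invFun s := homMk'
    (fun {X} x => A.act (x.down ≫ powerProj (0 : Fin (p.unop.len + 1)))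
      (A.sheaf.obj.map (quotientMap p x).op s))
    (fun {X Y} i x => by
      rw [A.map_act]
      refine congrArg (A.act _) ?_
      exact ConcreteCategory.congr_hom
        (A.sheaf.obj.map_comp (quotientMap p x).op i.op) s)
    -- The quotients `g_0⁻¹ g_i` are unchanged by left multiplication, so `g` enters only through
    -- the factor `g_0`.
    (fun {X} g x => by
      rw [← A.mul_act]
      refine congrArg (A.act _) (congrArg (fun q : X ⟶ power G (Fin p.unop.len) =>
        A.sheaf.obj.map q.op s) (power_ext fun i => ?_))
      change (g * (x.down ≫ powerProj (0 : Fin (p.unop.len + 1))))⁻¹ *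
        (g * (x.down ≫ powerProj i.succ)) = (x.down ≫ powerProj (0 : Fin (p.unop.len + 1)))⁻¹ *
        (x.down ≫ powerProj i.succ)
      group)
  left_inv ψ := hom_ext' fun {X} x => by
    rw [homMk'_app, ← app_map, ← app_act, act_map_universalSection]
  right_inv s := by
    change A.act (1 : power G (Fin p.unop.len) ⟶ G)
      (A.sheaf.obj.map (quotientMap p (universalSection p)).op s) = s
    have : quotientMap p (universalSection p) = 𝟙 (power G (Fin p.unop.len)) :=
      power_ext fun i => by
        change (1 : _ ⟶ G)⁻¹ * powerProj i = powerProj i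
        simp
    rw [A.one_act, this, op_id, CategoryTheory.Functor.map_id]
    rfl
  map_add' ψ ψ' := rfl

/-- `Γ(y(E_p G), A) = A(G ^ p)`, naturally in `A`. -/
noncomputable def sectionsIso :
    sections.obj (op (EObj (G := G) p)) ≅ secFunctor G (power G (Fin p.unop.len)) :=
  NatIso.ofComponents (fun A => AddEquiv.toAddCommGrpIso
    (X := AddCommGrpCat.of (EObj (G := G) p ⟶ A.toClassifyingTopos))
    (Y := AddCommGrpCat.of (A.sec (power G (Fin p.unop.len)))) (sectionsEquiv p A))
    (fun _ => rfl)

end Torsor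

variable (G) in
/-- The cochain complex of `Γ(E_• G, A)`, functorially in `A`. -/
noncomputable def cochains : AbObject G ⥤ CochainComplex AddCommGrpCat.{u + 1} ℕ :=
  cosimplicialSections G ⋙ AlgebraicTopology.alternatingCofaceMapComplex AddCommGrpCat.{u + 1}

instance : (cochains G).Additive where
  map_add := by
    intro A B f g
    ext n x
    rfl

/-- Exactness of complexes is tested degreewise, and in degree `p` the functor is sections over the
manifold `G^p`. -/
theorem shortExact_map_cochains [IsUltrametricDist K] [CompleteSpace K]
    (S : ShortComplex (AbObject G)) (hS : S.ShortExact) : (S.map (cochains G)).ShortExact := by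
  refine HomologicalComplex.shortExact_of_degreewise_shortExact _ fun p => ?_
  change (S.map (sections.obj (op (EObj (op (SimplexCategory.mk p)))))).ShortExact
  exact (ShortComplex.shortExact_iff_of_iso (S.mapNatIso (sectionsIso _))).2
    (shortExact_map_secFunctor _ hS)

end AbObject

/-! ### Acyclicity of injective objects -/

namespace AbObject

open ClassifyingTopos ActSite Limits

variable {K : Type u} [NontriviallyNormedField K]
variable {G : AnMan K} [Group G] [LieGroup 𝓘(K, G.model) ω G]

/-- Evaluation of morphisms of `BG` at a section, as a group homomorphism. -/
def appHom {B : ClassifyingTopos G} (A : AbObject G) {X : AnMan K}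
    (s : B.sheaf.obj.obj (op X)) : (B ⟶ A.toClassifyingTopos) →+ A.sec X :=
  AddMonoidHom.mk' (fun f => app f s) (fun _ _ => rfl)

variable (G) in
/-- The object `y(E_n G)` of `BG`. -/
noncomputable abbrev EPower (n : ℕ) : ClassifyingTopos G := EObj (op (SimplexCategory.mk n))

/-- The face maps of `y(E_• G)`. -/
noncomputable def face {n : ℕ} (i : Fin (n + 2)) : EPower G (n + 1) ⟶ EPower G n :=
  (simplicialE G).δ i

/-- The differential of the complex `Γ(E_• G, A)`, on cochains. -/
noncomputable def cochainsD (A : AbObject G) (n : ℕ) :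
    (EPower G n ⟶ A.toClassifyingTopos) →+ (EPower G (n + 1) ⟶ A.toClassifyingTopos) :=
  (((cochains G).obj A).d n (n + 1)).hom

theorem cochainsD_apply (A : AbObject G) (n : ℕ) (ψ : EPower G n ⟶ A.toClassifyingTopos) :
    cochainsD A n ψ = ∑ i : Fin (n + 2), (-1 : ℤ) ^ (i : ℕ) • (face i ≫ ψ) := by
  let ev : ((sections.obj (op (EPower G n))).obj A ⟶
      (sections.obj (op (EPower G (n + 1)))).obj A) →+
      (EPower G (n + 1) ⟶ A.toClassifyingTopos) :=
    AddMonoidHom.mk' (fun φ => φ ψ) (fun _ _ => rfl)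
  have h : ((cochains G).obj A).d n (n + 1) = ∑ i : Fin (n + 2), (-1 : ℤ) ^ (i : ℕ) •
      ((sections.map (face (G := G) i).op).app A) := by
    have h' := CochainComplex.of_d (fun n => ((cosimplicialSections G).obj A).obj (.mk n))
      (AlgebraicTopology.AlternatingCofaceMapComplex.objD ((cosimplicialSections G).obj A)) n
    exact h'
  refine (congrArg ev h).trans ((map_sum ev _ _).trans ?_)
  exact Finset.sum_congr rfl fun i _ => map_zsmul ev _ _

theorem app_cochainsD (A : AbObject G) (n : ℕ) (ψ : EPower G n ⟶ A.toClassifyingTopos)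
    {X : AnMan K} (x : (EPower G (n + 1)).sheaf.obj.obj (op X)) :
    app (cochainsD A n ψ) x =
      ∑ i : Fin (n + 2), (-1 : ℤ) ^ (i : ℕ) • (app ψ (app (face i) x) : A.sec X) := by
  rw [cochainsD_apply]
  refine (map_sum (appHom A x) _ _).trans ?_
  exact Finset.sum_congr rfl fun i _ => map_zsmul (appHom A x) _ _

section FreePresheaf

/-- The presheaf of free abelian groups on the sections of an object of `BG`. -/
noncomputable def freePresheaf (B : ClassifyingTopos G) :
    (ActSite G)ᵒᵖ ⥤ AddCommGrpCat.{u + 1} where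
  obj X := AddCommGrpCat.of (FreeAbelianGroup (B.sheaf.obj.obj (op X.unop.base)))
  map a := AddCommGrpCat.ofHom (FreeAbelianGroup.map fun s =>
    B.act (ActSite.Hom.tw a.unop) (B.sheaf.obj.map (ActSite.Hom.map a.unop).op s))
  map_id X := by
    ext s
    refine (FreeAbelianGroup.map_of_apply _).trans (congrArg FreeAbelianGroup.of ?_)
    change B.act 1 (B.sheaf.obj.map (𝟙 _) s) = s
    rw [B.one_act, CategoryTheory.Functor.map_id]; rfl
  map_comp a b := by
    ext s
    refine (FreeAbelianGroup.map_of_apply _).trans ?_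
    refine Eq.trans (congrArg FreeAbelianGroup.of ?_) ((congrArg (FreeAbelianGroup.map _)
      (FreeAbelianGroup.map_of_apply _)).trans (FreeAbelianGroup.map_of_apply _)).symm
    change B.act (_ * _)
        (B.sheaf.obj.map ((ActSite.Hom.map a.unop).op ≫ (ActSite.Hom.map b.unop).op) s) =
      B.act _ (B.sheaf.obj.map _ (B.act _ (B.sheaf.obj.map _ s)))
    rw [B.mul_act, B.map_act, CategoryTheory.Functor.map_comp]
    rfl

/-- A morphism of `BG` induces a morphism between the free presheaves. -/
noncomputable def freePresheafMap {B B' : ClassifyingTopos G} (f : B ⟶ B') :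
    freePresheaf B ⟶ freePresheaf B' where
  app X := AddCommGrpCat.ofHom (FreeAbelianGroup.map fun s => app f s)
  naturality X Y a := by
    refine AddCommGrpCat.hom_ext (FreeAbelianGroup.lift_ext _ _ fun s => ?_)
    refine ((congrArg (FreeAbelianGroup.map _) (FreeAbelianGroup.map_of_apply _)).trans
      (FreeAbelianGroup.map_of_apply _)).trans (Eq.trans (congrArg FreeAbelianGroup.of ?_)
      ((congrArg (FreeAbelianGroup.map _) (FreeAbelianGroup.map_of_apply _)).trans
        (FreeAbelianGroup.map_of_apply _)).symm)
    rw [app_act, app_map]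

/-- A morphism of `BG` to an abelian group object extends to the free presheaf. -/
noncomputable def freePresheafLift {B : ClassifyingTopos G} {A : AbObject G}
    (f : B ⟶ A.toClassifyingTopos) : freePresheaf B ⟶ A.toPresheaf where
  app X := AddCommGrpCat.ofHom (FreeAbelianGroup.lift (β := A.sec X.unop.base) fun s => app f s)
  naturality X Y a := by
    refine AddCommGrpCat.hom_ext (FreeAbelianGroup.lift_ext _ _ fun s => ?_)
    refine ((congrArg (FreeAbelianGroup.lift _) (FreeAbelianGroup.map_of_apply _)).trans
      (FreeAbelianGroup.lift_apply_of _ _)).trans (Eq.trans ?_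
      (congrArg (A.toPresheaf.map a) (FreeAbelianGroup.lift_apply_of _ _)).symm)
    rw [app_act, app_map]
    rfl

/-- The morphism of `BG` underlying a morphism from the free presheaf. -/
noncomputable def ofFreePresheaf {B : ClassifyingTopos G} {A : AbObject G}
    (φ : freePresheaf B ⟶ A.toPresheaf) : B ⟶ A.toClassifyingTopos :=
  have hφ : ∀ {X Y : ActSite G} (a : Y ⟶ X) (s : B.sheaf.obj.obj (op X.base)),
      φ.app (op Y) (FreeAbelianGroup.of
        (B.act (ActSite.Hom.tw a) (B.sheaf.obj.map (ActSite.Hom.map a).op s))) =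
      A.act (ActSite.Hom.tw a) (A.sheaf.obj.map (ActSite.Hom.map a).op
        (φ.app (op X) (FreeAbelianGroup.of s))) := fun {X Y} a s =>
    (congrArg (φ.app (op Y)) (FreeAbelianGroup.map_of_apply (α := B.sheaf.obj.obj (op X.base))
      _).symm).trans (ConcreteCategory.congr_hom (φ.naturality a.op) (FreeAbelianGroup.of s))
  homMk' (fun {X} s => φ.app (op ⟨X⟩) (FreeAbelianGroup.of s))
    (fun {X Y} i s => by
      have := hφ ((incl G).map i) s
      change φ.app (op ⟨Y⟩) (FreeAbelianGroup.of (B.act 1 (B.sheaf.obj.map i.op s))) =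
        A.act 1 (A.sheaf.obj.map i.op (φ.app (op ⟨X⟩) (FreeAbelianGroup.of s))) at this
      rwa [A.one_act, B.one_act] at this)
    (fun {X} g s => by
      have := hφ (twist (⟨X⟩ : ActSite G) g) s
      change φ.app (op ⟨X⟩) (FreeAbelianGroup.of (B.act g (B.sheaf.obj.map (𝟙 (op X)) s))) =
        A.act g (A.sheaf.obj.map (𝟙 (op X)) (φ.app (op ⟨X⟩) (FreeAbelianGroup.of s))) at this
      rw [CategoryTheory.Functor.map_id, CategoryTheory.Functor.map_id] at this
      exact this)

variable (G) in
/-- The differential of the complex of free presheaves on `E_• G`. -/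
noncomputable def freeBoundary (n : ℕ) :
    freePresheaf (EPower G (n + 1)) ⟶
      freePresheaf (EPower G n) :=
  ∑ i : Fin (n + 2), (-1 : ℤ) ^ (i : ℕ) • freePresheafMap (face i)

theorem freeBoundary_app_of (n : ℕ) {X : ActSite G}
    (x : (EPower G (n + 1)).sheaf.obj.obj (op X.base)) :
    (freeBoundary G n).app (op X) (FreeAbelianGroup.of x) =
      ∑ i : Fin (n + 2), (-1 : ℤ) ^ (i : ℕ) •
        FreeAbelianGroup.of (app (face i) x) := by
  let ev : (freePresheaf (EPower G (n + 1)) ⟶ freePresheaf (EPower G n)) →+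
      FreeAbelianGroup ((EPower G n).sheaf.obj.obj (op X.base)) :=
    AddMonoidHom.mk' (fun φ => φ.app (op X) (FreeAbelianGroup.of x)) (fun _ _ => rfl)
  refine (map_sum ev _ _).trans (Finset.sum_congr rfl fun i _ => (map_zsmul ev _ _).trans ?_)
  exact congrArg ((-1 : ℤ) ^ (i : ℕ) • ·) (FreeAbelianGroup.map_of_apply x)

/-- The contraction `(g_0, …, g_p) ↦ (1, g_0, …, g_p)` of `E_• G` on sections. -/
noncomputable def consOne {n : ℕ} {X : AnMan K}
    (x : (EPower G n).sheaf.obj.obj (op X)) :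
    (EPower G (n + 1)).sheaf.obj.obj (op X) :=
  ULift.up (powerLift (Fin.cons (α := fun _ => X ⟶ G) 1
    (fun i : Fin (n + 1) => x.down ≫ powerProj i)))

/-- With `δ_succ_consOne`, these are the identities of an extra degeneracy. It is not equivariant,
so it contracts the free complex only over each object of the site, not as presheaves. -/
theorem δ_zero_consOne {n : ℕ} {X : AnMan K}
    (x : (EPower G n).sheaf.obj.obj (op X)) :
    app (face 0) (consOne x) = x :=
  ULift.ext _ _ (power_ext fun _ => rfl)

theorem δ_succ_consOne {n : ℕ} {X : AnMan K} (j : Fin (n + 2))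
    (x : (EPower G (n + 1)).sheaf.obj.obj (op X)) :
    app (face j.succ) (consOne x) = consOne (app (face j) x) := by
  refine ULift.ext _ _ (power_ext fun i => ?_)
  change Fin.cons (α := fun _ => X ⟶ G) 1 (fun i : Fin (n + 2) => x.down ≫ powerProj i)
    (j.succ.succAbove i) = Fin.cons (α := fun _ => X ⟶ G) 1
      (fun i : Fin (n + 1) => x.down ≫ powerProj (j.succAbove i)) i
  refine Fin.cases ?_ (fun i => ?_) i
  · rw [Fin.succ_succAbove_zero]
    rfl
  · rw [Fin.succ_succAbove_succ]
    rfl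

/-- The complex of free presheaves on `E_• G` is exact in positive degrees. -/
theorem exists_freeBoundary_eq (n : ℕ) {X : ActSite G}
    (z : FreeAbelianGroup
      ((EPower G (n + 1)).sheaf.obj.obj (op X.base)))
    (hz : (freeBoundary G n).app (op X) z = 0) :
    ∃ w, (freeBoundary G (n + 1)).app (op X) w = z := by
  let T := fun m : ℕ =>
    FreeAbelianGroup ((EPower G m).sheaf.obj.obj (op X.base))
  let d : ∀ m, T (m + 1) →+ T m := fun m => ((freeBoundary G m).app (op X)).hom
  let h : ∀ m, T m →+ T (m + 1) := fun m => FreeAbelianGroup.map consOne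
  -- In `d h x` the face `0` returns `x`. The face `i + 1` cancels the term of index `i` in `h d x`,
  -- since the signs are opposite.
  have key : (d (n + 1)).comp (h (n + 1)) + (h n).comp (d n) = AddMonoidHom.id _ := by
    ext x
    have h1 : h (n + 1) (FreeAbelianGroup.of x) = FreeAbelianGroup.of (consOne x) :=
      FreeAbelianGroup.map_of_apply _
    have h2 : d n (FreeAbelianGroup.of x) = _ := freeBoundary_app_of n x
    have h3 : d (n + 1) (FreeAbelianGroup.of (consOne x)) = _ :=
      freeBoundary_app_of (n + 1) (consOne x)
    change d (n + 1) (h (n + 1) (FreeAbelianGroup.of x)) +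
      h n (d n (FreeAbelianGroup.of x)) = FreeAbelianGroup.of x
    rw [h1, h2, h3, Fin.sum_univ_succ, map_sum, add_assoc, ← Finset.sum_add_distrib]
    rw [Finset.sum_eq_zero, add_zero, δ_zero_consOne]
    · simp
    · intro i _
      have h4 : h n (FreeAbelianGroup.of (app (face i) x)) = _ :=
        FreeAbelianGroup.map_of_apply _
      rw [map_zsmul, h4, δ_succ_consOne, ← add_smul]
      simp [pow_succ]
  refine ⟨h (n + 1) z, ?_⟩
  have := DFunLike.congr_fun key z
  change d (n + 1) (h (n + 1) z) + h n (d n z) = z at this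
  rwa [show d n z = 0 from hz, map_zero, add_zero] at this

/-- When cochains are read as morphisms from free presheaves, the differential is precomposition
with the boundary. -/
theorem freePresheafLift_app_freeBoundary_of {A : AbObject G} (n : ℕ)
    (ψ : EPower G n ⟶ A.toClassifyingTopos) {X : ActSite G}
    (x : (EPower G (n + 1)).sheaf.obj.obj (op X.base)) :
    (freePresheafLift ψ).app (op X) ((freeBoundary G n).app (op X) (FreeAbelianGroup.of x)) =
      app (cochainsD A n ψ) x := by
  rw [freeBoundary_app_of, app_cochainsD]
  refine (map_sum ((freePresheafLift ψ).app (op X)).hom _ _).trans ?_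
  refine Finset.sum_congr rfl fun i _ => (map_zsmul _ _ _).trans ?_
  exact congrArg ((-1 : ℤ) ^ (i : ℕ) • ·) (FreeAbelianGroup.lift_apply_of _ _)

end FreePresheaf

/-- The presheaf of an injective abelian group object is injective. -/
instance (I : AbObject G) [Injective I] : Injective I.toPresheaf := by
  have : EssentiallySmall.{u + 1} (ActSite G) := inferInstance
  have h : Injective ((toSheaf G).obj I) :=
    Injective.injective_of_adjoint (toSheaf G).asEquivalence.symm.toAdjunction I
  -- The inclusion of sheaves into presheaves has an exact left adjoint, sheafification, so it
  -- preserves injectives.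
  exact Injective.injective_of_adjoint
    (sheafificationAdjunction (ActSite.topology G) AddCommGrpCat.{u + 1}) ((toSheaf G).obj I)

/-- Injective abelian group objects are acyclic for `Γ(E_• G, -)`. -/
theorem isZero_homology_cochains (I : AbObject G) [Injective I] (n : ℕ) :
    IsZero (((cochains G).obj I).homology (n + 1)) := by
  rw [← HomologicalComplex.exactAt_iff_isZero_homology,
    HomologicalComplex.exactAt_iff' _ n (n + 1) (n + 2) (by simp) (by simp),
    ShortComplex.ab_exact_iff]
  intro c hc
  let c' : EPower G (n + 1) ⟶ I.toClassifyingTopos := c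
  -- Every element of the kernel is a boundary from the next degree, and a cocycle vanishes on
  -- boundaries.
  have h0 : kernel.ι (freeBoundary G n) ≫ freePresheafLift c' = 0 := by
    ext X z
    obtain ⟨w, hw⟩ := exists_freeBoundary_eq n ((kernel.ι (freeBoundary G n)).app X z)
      (ConcreteCategory.congr_hom (NatTrans.congr_app (kernel.condition (freeBoundary G n)) X) z)
    change (freePresheafLift c').app X ((kernel.ι (freeBoundary G n)).app X z) = 0
    rw [← hw]
    have h1 : ((freePresheafLift c').app X).hom.comp ((freeBoundary G (n + 1)).app X).hom = 0 := by
      refine FreeAbelianGroup.lift_ext _ _ fun x => ?_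
      refine (freePresheafLift_app_freeBoundary_of (X := X.unop) (n + 1) c' x).trans ?_
      exact congrArg (fun f : EPower G (n + 2) ⟶
        I.toClassifyingTopos => app f x) hc
    exact DFunLike.congr_fun h1 w
  have hex : (ShortComplex.mk _ _ (kernel.condition (freeBoundary G n))).Exact :=
    ShortComplex.exact_of_f_is_kernel _ (kernelIsKernel _)
  -- The cocycle factors through the image of the boundary, and injectivity of `I` as a presheaf
  -- extends it to all of `ℤ[E_nG]`. The extension is the cochain whose coboundary is `c`.
  let β : freePresheaf (EPower G n) ⟶ I.toPresheaf :=
    hex.descToInjective (freePresheafLift c') h0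
  have hβ : freeBoundary G n ≫ β = freePresheafLift c' := hex.comp_descToInjective _ _
  refine ⟨ofFreePresheaf β, hom_ext' (B := I.toClassifyingTopos) fun {X} x => ?_⟩
  refine (app_cochainsD I n (ofFreePresheaf β) x).trans ?_
  have h2 := ConcreteCategory.congr_hom (NatTrans.congr_app hβ (op ⟨X⟩)) (FreeAbelianGroup.of x)
  refine Eq.trans ?_ (h2.trans (FreeAbelianGroup.lift_apply_of _ _))
  refine Eq.symm ((congrArg (β.app (op ⟨X⟩)) (freeBoundary_app_of n (X := ⟨X⟩) x)).trans ?_)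
  refine (map_sum (β.app (op ⟨X⟩)).hom _ _).trans ?_
  exact Finset.sum_congr rfl fun i _ => map_zsmul _ _ _

end AbObject

/-! ### Global sections as degree-zero cohomology -/

namespace AbObject

open ClassifyingTopos ActSite Limits

variable {K : Type u} [NontriviallyNormedField K]
variable {G : AnMan K} [Group G] [LieGroup 𝓘(K, G.model) ω G]

variable (G) in
/-- The morphism `y(E_0 G) ⟶ *`. -/
noncomputable def augmentation : EPower G 0 ⟶ terminal G := isTerminalTerminal.from _

/-- The global section given by a cocycle in degree zero. -/
noncomputable def globalSectionOfCocycle {A : AbObject G} (ψ : EPower G 0 ⟶ A.toClassifyingTopos)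
    (hψ : cochainsD A 0 ψ = 0) : {s : terminal G ⟶ A.toClassifyingTopos // augmentation G ≫ s = ψ} :=
  have h : ∀ {X : AnMan K} (x y : (EPower G 0).sheaf.obj.obj (op X)), app ψ x = app ψ y :=
    fun {X} x y => by
      -- The 1-simplex `(x, y)`: face `0` drops `x` and face `1` drops `y`, so the cocycle condition
      -- at `z` reads `ψ y - ψ x = 0`.
      let z : (EPower G 1).sheaf.obj.obj (op X) := ULift.up (powerLift (Fin.cons
        (α := fun _ => X ⟶ G) (x.down ≫ powerProj (0 : Fin 1))
          (fun _ : Fin 1 => y.down ≫ powerProj (0 : Fin 1))))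
      have hy : app (face (G := G) (0 : Fin 2)) z = y := by
        refine ULift.ext _ _ (power_ext fun i => ?_)
        obtain rfl : i = 0 := Subsingleton.elim (α := Fin 1) _ _
        rfl
      have hx : app (face (G := G) (1 : Fin 2)) z = x := by
        refine ULift.ext _ _ (power_ext fun i => ?_)
        obtain rfl : i = 0 := Subsingleton.elim (α := Fin 1) _ _
        rfl
      have h := app_cochainsD A 0 ψ z
      rw [hψ, Fin.sum_univ_two, hx, hy, zero_app] at h
      simp only [Fin.val_zero, Fin.val_one, pow_zero, pow_one, one_smul, neg_smul] at h
      exact (sub_eq_zero.1 ((sub_eq_add_neg _ _).trans h.symm)).symm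
  -- Since `ψ` is constant over each manifold, any base section would do. The constant `1` exists
  -- everywhere and is compatible with restriction, and its translates by `G` have the same value
  -- under `ψ`.
  let one : ∀ X : AnMan K, (EPower G 0).sheaf.obj.obj (op X) := fun X =>
    ULift.up (powerLift fun _ => 1)
  ⟨homMk' (fun {X} _ => app ψ (one X)) (fun {X Y} i _ => (app_map ψ i (one X)))
    (fun {X} g _ => (h _ _).trans (app_act ψ g (one X))), hom_ext' fun {X} x => h _ _⟩

/-- `y(E_0 G)` has a section over every manifold, so a morphism from the terminal object can be
recovered after composing with the augmentation. -/
theorem augmentation_comp_injective {A : AbObject G} :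
    Function.Injective fun s : terminal G ⟶ A.toClassifyingTopos => augmentation G ≫ s :=
  fun _ _ h => hom_ext' fun {X} _ => congrArg (fun f : EPower G 0 ⟶ A.toClassifyingTopos =>
    app f (ULift.up (powerLift fun _ => 1) : (EPower G 0).sheaf.obj.obj (op X))) h

/-- The augmentation of the complex `Γ(E_• G, A)` by the global sections. -/
noncomputable def cochainsAugmentation (A : AbObject G) :
    (globalSections G).obj A ⟶ ((cochains G).obj A).X 0 :=
  (sections.map (augmentation G).op).app A

theorem cochainsAugmentation_d (A : AbObject G) :
    cochainsAugmentation A ≫ ((cochains G).obj A).d 0 1 = 0 := by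
  ext s
  change cochainsD A 0 (augmentation G ≫ s) = 0
  refine hom_ext' fun {X} x => (app_cochainsD A 0 _ x).trans ?_
  rw [Fin.sum_univ_two]
  change (-1 : ℤ) ^ 0 • (app s PUnit.unit : A.sec X) +
    (-1 : ℤ) ^ 1 • (app s PUnit.unit : A.sec X) = 0
  rw [pow_zero, pow_one, one_smul, neg_smul, one_smul, add_neg_cancel]

instance (A : AbObject G) : Mono (cochainsAugmentation A) :=
  (AddCommGrpCat.mono_iff_injective _).2 augmentation_comp_injective

theorem exact_cochainsAugmentation (A : AbObject G) :
    (ShortComplex.mk _ _ (cochainsAugmentation_d A)).Exact := by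
  rw [ShortComplex.ab_exact_iff]
  intro ψ hψ
  exact ⟨(globalSectionOfCocycle ψ hψ).1, (globalSectionOfCocycle ψ hψ).2⟩

/-- The global sections are the cocycles in degree zero. -/
noncomputable def globalSectionsToHomology (A : AbObject G) :
    (globalSections G).obj A ⟶ ((cochains G).obj A).homology 0 :=
  HomologicalComplex.liftCycles _ (cochainsAugmentation A) 1 (by simp) (cochainsAugmentation_d A) ≫
    HomologicalComplex.homologyπ _ 0

instance (A : AbObject G) : IsIso (globalSectionsToHomology A) := by
  have : IsIso (HomologicalComplex.liftCycles _ (cochainsAugmentation A) 1 (by simp)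
      (cochainsAugmentation_d A)) := by
    rw [CochainComplex.isIso_liftCycles_iff]
    exact ⟨exact_cochainsAugmentation A, inferInstance⟩
  unfold globalSectionsToHomology
  infer_instance

variable (G) in
/-- `Γ(A) = H^0(Γ(E_• G, A))`, naturally in `A`. -/
noncomputable def globalSectionsIso :
    globalSections G ≅ cochains G ⋙ HomologicalComplex.homologyFunctor _ _ 0 :=
  NatIso.ofComponents (fun A => (asIso (globalSectionsToHomology A) :
    (globalSections G).obj A ≅ ((cochains G).obj A).homology 0)) fun {A B} f => by
    have h : (globalSections G).map f ≫ HomologicalComplex.liftCycles _ (cochainsAugmentation B) 1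
        (by simp) (cochainsAugmentation_d B) =
        HomologicalComplex.liftCycles _ (cochainsAugmentation A) 1
          (by simp) (cochainsAugmentation_d A) ≫
          HomologicalComplex.cyclesMap ((cochains G).map f) 0 :=
      comp_eq_comp_of_mono (HomologicalComplex.liftCycles_i _ _ _ _ _)
        (HomologicalComplex.liftCycles_i _ _ _ _ _) (HomologicalComplex.cyclesMap_i _ _) rfl
    exact (comp_eq_comp_of_squares h (HomologicalComplex.homologyπ_naturality _ _).symm)

end AbObject

/-! ### The comparison isomorphism -/

theorem mainTheorem7 {K : Type u} [NontriviallyNormedField K] [IsUltrametricDist K]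
    [CompleteSpace K] [CharZero K] (G : AnMan K) [Group G] [LieGroup 𝓘(K, G.model) ω G] (n : ℕ) :
    Nonempty ((AbObject.globalSections G).rightDerived n ≅ AbObject.cochainCohomology G n) := by
  obtain ⟨e⟩ := CochainComplex.nonempty_rightDerived_iso (AbObject.cochains G)
    AbObject.shortExact_map_cochains (fun I _ => AbObject.isZero_homology_cochains I) n
  let i := AbObject.globalSectionsIso G
  -- Right derived functors are functorial in the functor, so `Γ ≅ H^0` carries over to `R^nΓ ≅
  -- R^n(H^0)`.
  have h1 : NatTrans.rightDerived i.hom n ≫ NatTrans.rightDerived i.inv n = 𝟙 _ := by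
    rw [← NatTrans.rightDerived_comp, i.hom_inv_id, NatTrans.rightDerived_id]
  have h2 : NatTrans.rightDerived i.inv n ≫ NatTrans.rightDerived i.hom n = 𝟙 _ := by
    rw [← NatTrans.rightDerived_comp, i.inv_hom_id, NatTrans.rightDerived_id]
  exact ⟨⟨NatTrans.rightDerived i.hom n, NatTrans.rightDerived i.inv n, h1, h2⟩ ≪≫ e⟩
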